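/- Let $K$ be an (ordinary) differential field of characteristic $0$ with derivation $\partial$, let $\bar K$ be a differential closure of $K$ (a differentially closed extension of $K$ that embeds over $K$ into every differentially closed extension of $K$), and let $U$ be a differential field extension of $\bar K$, for instance a semi-universal one. Let $V$ be a finite-dimensional $K$-vector space with a basis $v=(v_1,\dots,v_n)$, and let $G\subset \mathrm{GL}(V)(U)=\mathrm{GL}_U(U\otimes_K V)$ be a linear differential algebraic group over $K$, that is, a subgroup consisting of all $g$ whose matrix entries with respect to $v$ satisfy a given system of differential polynomial equations with coefficients in $K$. Thus $V$ is a faithful representation of $G$. For $p\ge 0$ let $V^{(p)}=K[\partial]_{\le p}\otimes_K V$, where $K[\partial]_{\le p}$ is the space of linear differential operators of order at most $p$ (a right $K$-space via $\partial a=a\partial+\partial(a)$). The group $G$ acts on $U\otimes_K V^{(p)}=(U\otimes_K V)^{(p)}$ by $g(\partial^i\otimes w)=\partial^i\otimes gw$ for $w\in U\otimes_K V$, and diagonally on $U\otimes_K(V\oplus V_1\oplus\dots\oplus V_p)$, where each $V_i$ is a copy of the representation $V$. A $\bar K$-linear isomorphism $\bar K\otimes_K X\to\bar K\otimes_K Y$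 between such representations is called $G$-equivariant if its extension of scalars $U\otimes_K X\to U\otimes_K Y$ commutes with the action of every $g\in G$. Say that $G$ is conjugate over $\bar K$ to a group of constant matrices if there are $D\in \mathrm{GL}_n(\bar K)$ and a subgroup $H$ of $\mathrm{GL}_n(C_U)$, where $C_U=\{c\in U:\partial c=0\}$, such that $D^{-1}A_gD$ runs exactly through $H$ as $g$ runs through $G$, where $A_g\in\mathrm{GL}_n(U)$ is the matrix of $g$ with respect to $v$. Then the following are equivalent: 1. $G$ is conjugate over $\bar K$ to a group of constant matrices; 2. for all $p\ge 1$ there is a $G$-equivariant $\bar K$-linear isomorphism $$\bar K\otimes_K\bigl(V\oplus V_1\oplus\dots\oplus V_p\bigr)\;\cong\;\bar K\otimes_K V^{(p)};$$ 3. for all $p\ge 1$ there is such an isomorphism which restricts on the first summand $\bar K\otimes_K V$ to the canonical inclusion $c\otimes w\mapsto c\otimes(1\otimes w)$ (that is, $\bar K\otimes_K V^{(p)}$ is the internal direct sum of $\bar K\otimes_K V$ and $p$ $G$-stable subspaces isomorphic to it). -/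

import Mathlib

open scoped TensorProduct Differential

namespace DiffAlg

/-! ### Differential fields -/

section Basic

/-- The `k`-th derivative `∂^k a` of an element of a differential ring. -/
def iterDeriv {R : Type*} [CommRing R] [Differential R] (k : ℕ) (a : R) : R :=
  (fun x : R => x′)^[k] a

variable {R : Type*} [CommRing R] [Differential R]

@[simp] lemma iterDeriv_zero (a : R) : iterDeriv 0 a = a := rfl

lemma iterDeriv_succ (k : ℕ) (a : R) : iterDeriv (k + 1) a = (iterDeriv k a)′ :=
  Function.iterate_succ_apply' _ _ _

lemma iterDeriv_add (k : ℕ) (a b : R) :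
    iterDeriv k (a + b) = iterDeriv k a + iterDeriv k b := by
  induction k with
  | zero => rfl
  | succ k ih => simp [iterDeriv_succ, ih]

lemma iterDeriv_zero_right (k : ℕ) : iterDeriv k (0 : R) = 0 := by
  induction k with
  | zero => rfl
  | succ k ih => simp [iterDeriv_succ, ih]

lemma iterDeriv_one (k : ℕ) : iterDeriv k (1 : R) = if k = 0 then 1 else 0 := by
  cases k with
  | zero => rfl
  | succ k =>
    simp only [Nat.succ_ne_zero, if_false]
    induction k with
    | zero => simp [iterDeriv_succ]
    | succ k ih => rw [iterDeriv_succ, ih]; simp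

lemma iterDeriv_iterDeriv (j k : ℕ) (a : R) :
    iterDeriv j (iterDeriv k a) = iterDeriv (j + k) a :=
  (Function.iterate_add_apply _ _ _ _).symm

lemma iterDeriv_intCast_mul (k : ℕ) (c : ℤ) (a : R) :
    iterDeriv k ((c : R) * a) = c * iterDeriv k a := by
  induction k with
  | zero => rfl
  | succ k ih => simp [iterDeriv_succ, ih]

lemma iterDeriv_mul (n : ℕ) (a b : R) :
    iterDeriv n (a * b) = ∑ m ∈ Finset.range (n + 1),
      (n.choose m : R) * (iterDeriv m a * iterDeriv (n - m) b) := by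
  rw [← Finset.Nat.sum_antidiagonal_eq_sum_range_succ
    (fun i j => (n.choose i : R) * (iterDeriv i a * iterDeriv j b))]
  induction n with
  | zero => simp
  | succ n ih =>
    rw [Finset.sum_antidiagonal_choose_succ_mul
      (fun i j => iterDeriv i a * iterDeriv j b) n, iterDeriv_succ, ih, map_sum,
      ← Finset.sum_add_distrib]
    refine Finset.sum_congr rfl fun ij hij => ?_
    have hc : n.choose ij.2 = n.choose ij.1 := by
      rw [← Finset.HasAntidiagonal.mem_antidiagonal.1 hij, Nat.choose_symm_add]
    simp only [Derivation.leibniz, iterDeriv_succ, smul_eq_mul, Derivation.map_natCast, hc]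
    ring

lemma iterDeriv_algebraMap {A B : Type*} [CommRing A] [CommRing B] [Algebra A B]
    [Differential A] [Differential B] [DifferentialAlgebra A B] (k : ℕ) (a : A) :
    iterDeriv k (algebraMap A B a) = algebraMap A B (iterDeriv k a) := by
  induction k with
  | zero => rfl
  | succ k ih => rw [iterDeriv_succ, iterDeriv_succ, ih, deriv_algebraMap]

end Basic

/-- The value of a differential polynomial at a point. The ring of differential polynomials
`F{y_s | s ∈ σ}` is the polynomial ring in the variables `∂^k y_s`, indexed by `(s, k)`. -/
noncomputable def diffEval {σ F E : Type*} [CommRing F] [CommRing E] [Differential E]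
    [Algebra F E] (x : σ → E) (f : MvPolynomial (σ × ℕ) F) : E :=
  MvPolynomial.aeval (fun v : σ × ℕ => iterDeriv v.2 (x v.1)) f

universe u v

/-- A differential field `F` is differentially closed if every finite system of differential
polynomial equations and one inequation over `F` that has a solution in some differential
field extension of `F` has a solution in `F`. -/
def IsDifferentiallyClosed (F : Type u) [Field F] [Differential F] : Prop :=
  ∀ (E : Type u) [Field E] [Differential E] [Algebra F E] [DifferentialAlgebra F E]
    (n : ℕ) (S : Finset (MvPolynomial (Fin n × ℕ) F)) (g : MvPolynomial (Fin n × ℕ) F),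
    (∃ x : Fin n → E, (∀ f ∈ S, diffEval x f = 0) ∧ diffEval x g ≠ 0) →
      ∃ x : Fin n → F, (∀ f ∈ S, diffEval x f = 0) ∧ diffEval x g ≠ 0

/-- `L` is a differential closure of `K`: it is a differentially closed extension of `K` that
embeds over `K` into every differentially closed extension of `K`. -/
structure IsDifferentialClosure (K : Type u) (L : Type v) [Field K] [Differential K]
    [Field L] [Differential L] [Algebra K L] [DifferentialAlgebra K L] : Prop where
  closed : IsDifferentiallyClosed L
  embeds : ∀ (M : Type v) [Field M] [Differential M] [Algebra K M] [DifferentialAlgebra K M],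
    IsDifferentiallyClosed M → ∃ φ : L →ₐ[K] M, ∀ x : L, φ (x′) = (φ x)′

/-- The field of constants of a differential field. -/
def constants (F : Type*) [Field F] [Differential F] : Subfield F where
  carrier := {x | x′ = 0}
  mul_mem' {a b} ha hb := by
    simp only [Set.mem_ofPred_eq] at *
    simp [Derivation.leibniz, ha, hb]
  one_mem' := by simp
  add_mem' {a b} ha hb := by
    simp only [Set.mem_ofPred_eq] at *
    simp [ha, hb]
  zero_mem' := by simp
  neg_mem' {a} ha := by
    simp only [Set.mem_ofPred_eq] at *
    simp [ha]
  inv_mem' a ha := by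
    simp only [Set.mem_ofPred_eq] at *
    simp [Derivation.leibniz_inv, ha]

/-! ### Prolongation of vector spaces -/

/-- The prolongation `M^{(p)} = R[∂]_{≤ p} ⊗_R M`. As a right `R`-module `R[∂]_{≤ p}` is free on
`1, ∂, …, ∂^p`, so every element of `M^{(p)}` is uniquely `∑_{i ≤ p} ∂^i ⊗ m_i`; it is stored as
the family `(m_i)`. The (left) `R`-module structure is defined below. -/
def Prolongation (_R : Type*) (M : Type*) (p : ℕ) : Type _ := Fin (p + 1) → M

namespace Prolongation

/-- In `R[∂]` one has `a ∂^i = ∑_k ∂^k · (leftCoeff a k i)`, where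
`leftCoeff a k i = (-1)^{i-k} (i choose k) a^{(i-k)}` (which vanishes for `k > i`). -/
def leftCoeff {R : Type*} [CommRing R] [Differential R] (a : R) (k i : ℕ) : R :=
  (((-1) ^ (i - k) * (i.choose k : ℤ) : ℤ) : R) * iterDeriv (i - k) a

lemma sum_window {A : Type*} [AddCommMonoid A] (p k n : ℕ) (h : k + n ≤ p) (f : ℕ → A)
    (hf : ∀ j, ¬ (k ≤ j ∧ j ≤ k + n) → f j = 0) :
    ∑ j : Fin (p + 1), f j = ∑ m ∈ Finset.range (n + 1), f (k + m) := by
  rw [Fin.sum_univ_eq_sum_range f (p + 1)]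
  have h1 : ∑ m ∈ Finset.range (n + 1), f (k + m) = ∑ j ∈ Finset.Ico k (k + n + 1), f j := by
    rw [Finset.sum_Ico_eq_sum_range]
    congr 2
    omega
  rw [h1]
  symm
  refine Finset.sum_subset (fun j hj => ?_) (fun j _ hj => hf j fun h => hj ?_)
  · simp only [Finset.mem_Ico, Finset.mem_range] at *; omega
  · simp only [Finset.mem_Ico]; omega

section Module

set_option linter.unusedSectionVars false

variable {R : Type*} [CommRing R] [Differential R]

lemma leftCoeff_of_lt (a : R) {k i : ℕ} (h : i < k) : leftCoeff a k i = 0 := by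
  simp [leftCoeff, Nat.choose_eq_zero_of_lt h]

lemma leftCoeff_mul (a b : R) (p k i : ℕ) (hi : i ≤ p) :
    ∑ j : Fin (p + 1), leftCoeff a k j * leftCoeff b j i = leftCoeff (a * b) k i := by
  rcases lt_or_ge i k with h | h
  · rw [leftCoeff_of_lt _ h]
    refine Finset.sum_eq_zero fun j _ => ?_
    rcases lt_or_ge (j : ℕ) k with h' | h'
    · rw [leftCoeff_of_lt _ h', zero_mul]
    · rw [leftCoeff_of_lt b (by omega : i < j), mul_zero]
  · obtain ⟨n, rfl⟩ := Nat.exists_eq_add_of_le h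
    rw [sum_window p k n hi (fun j => leftCoeff a k j * leftCoeff b j (k + n))]
    · rw [leftCoeff, iterDeriv_mul, Finset.mul_sum]
      refine Finset.sum_congr (by simp) fun m hm => ?_
      have hm' : m ≤ n := by
        have := Finset.mem_range.1 hm
        omega
      have e : (k + n).choose (k + m) * (k + m).choose k = (k + n).choose k * n.choose m := by
        rw [Nat.choose_mul (by omega)]
        congr 2 <;> omega
      have e' : (((k + n).choose (k + m) : R)) * ((k + m).choose k : R)
          = ((k + n).choose k : R) * (n.choose m : R) := by
        exact_mod_cast congrArg (Nat.cast (R := R)) e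
      have s : ((-1 : R)) ^ n = (-1) ^ m * (-1) ^ (n - m) := by
        rw [← pow_add]; congr 1; omega
      simp only [leftCoeff, show k + m - k = m by omega, show k + n - (k + m) = n - m by omega,
        show k + n - k = n by omega]
      push_cast
      rw [s]
      linear_combination (-1 : R) ^ m * (-1) ^ (n - m) * iterDeriv m a * iterDeriv (n - m) b * e'
    · intro j hj
      rcases lt_or_ge j k with h' | h'
      · simp only [leftCoeff_of_lt a h', zero_mul]
      · have : k + n < j := by omega
        simp only [leftCoeff_of_lt b this, mul_zero]

lemma leftCoeff_add (a b : R) (k i : ℕ) :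
    leftCoeff (a + b) k i = leftCoeff a k i + leftCoeff b k i := by
  rw [leftCoeff, iterDeriv_add, mul_add]; rfl

lemma leftCoeff_one (k i : ℕ) : leftCoeff (1 : R) k i = if k = i then 1 else 0 := by
  rcases lt_trichotomy i k with h | rfl | h
  · rw [leftCoeff_of_lt _ h, if_neg h.ne']
  · simp [leftCoeff]
  · rw [leftCoeff, iterDeriv_one, if_neg (by omega), if_neg h.ne, mul_zero]

lemma leftCoeff_zero (k i : ℕ) : leftCoeff (0 : R) k i = 0 := by
  rw [leftCoeff, iterDeriv_zero_right, mul_zero]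

variable {M : Type*} [AddCommGroup M] [Module R M] {p : ℕ}

instance : AddCommGroup (Prolongation R M p) :=
  inferInstanceAs (AddCommGroup (Fin (p + 1) → M))

/-- Left multiplication: `a · (∂^i ⊗ m) = ∑_k ∂^k ⊗ (leftCoeff a k i • m)`. -/
instance : SMul R (Prolongation R M p) where
  smul a x := fun k => ∑ i : Fin (p + 1), leftCoeff a k i • x i

lemma smul_apply (a : R) (x : Prolongation R M p) (k : Fin (p + 1)) :
    (a • x) k = ∑ i : Fin (p + 1), leftCoeff a k i • x i := rfl

lemma add_apply (x y : Prolongation R M p) (k : Fin (p + 1)) : (x + y) k = x k + y k := rfl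

lemma zero_apply (k : Fin (p + 1)) : (0 : Prolongation R M p) k = 0 := rfl

instance : Module R (Prolongation R M p) where
  one_smul x := by
    funext k
    simp only [smul_apply, leftCoeff_one, Fin.val_inj, ite_smul, one_smul, zero_smul]
    exact Fintype.sum_ite_eq k x
  mul_smul a b x := by
    funext k
    simp only [smul_apply, Finset.smul_sum, smul_smul]
    rw [Finset.sum_comm]
    refine Finset.sum_congr rfl fun i _ => ?_
    rw [← Finset.sum_smul, leftCoeff_mul a b p k i (by omega)]
  smul_zero a := by
    funext k
    simp [smul_apply, zero_apply]
  smul_add a x y := by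
    funext k
    simp [smul_apply, add_apply, Finset.sum_add_distrib]
  add_smul a b x := by
    funext k
    simp [smul_apply, add_apply, leftCoeff_add, add_smul, Finset.sum_add_distrib]
  zero_smul x := by
    funext k
    simp [smul_apply, zero_apply, leftCoeff_zero]

variable (R) in
/-- The element `∂^i ⊗ m` of `M^{(p)}`. -/
def single (i : Fin (p + 1)) : M →+ Prolongation R M p :=
  AddMonoidHom.single (fun _ => M) i

lemma single_apply (i k : Fin (p + 1)) (m : M) :
    (single R i m : Prolongation R M p) k = if k = i then m else 0 :=
  Pi.single_apply i m k

lemma sum_single (x : Prolongation R M p) : ∑ i, single R i (x i) = x :=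
  Finset.univ_sum_single (M := fun _ : Fin (p + 1) => M) x

lemma smul_single (a : R) (i : Fin (p + 1)) (m : M) :
    a • (single R i m : Prolongation R M p) = ∑ k, single R k (leftCoeff a k i • m) := by
  rw [← sum_single (a • (single R i m : Prolongation R M p))]
  refine Finset.sum_congr rfl fun k _ => ?_
  congr 1
  simp [smul_apply, single_apply]

lemma sum_choose_mul_alternating (p i m : ℕ) (hi : i ≤ p) :
    ∑ j : Fin (p + 1), (i.choose j : ℤ) * ((-1) ^ ((j : ℕ) - m) * ((j : ℕ).choose m : ℤ))
      = if m = i then 1 else 0 := by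
  rcases lt_or_ge i m with h | h
  · rw [if_neg (by omega)]
    refine Finset.sum_eq_zero fun j _ => ?_
    rcases lt_or_ge i (j : ℕ) with h' | h'
    · simp [Nat.choose_eq_zero_of_lt h']
    · simp [Nat.choose_eq_zero_of_lt (show (j : ℕ) < m by omega)]
  · obtain ⟨n, rfl⟩ := Nat.exists_eq_add_of_le h
    rw [sum_window p m n hi
      (fun j => ((m + n).choose j : ℤ) * ((-1) ^ (j - m) * (j.choose m : ℤ)))]
    · have e : ∀ k, ((m + n).choose (m + k) : ℤ) * ((-1) ^ (m + k - m) * ((m + k).choose m : ℤ))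
          = ((m + n).choose m : ℤ) * ((-1) ^ k * (n.choose k : ℤ)) := by
        intro k
        have e1 : (m + n).choose (m + k) * (m + k).choose m = (m + n).choose m * n.choose k := by
          rw [Nat.choose_mul (by omega)]
          congr 2 <;> omega
        have e2 : ((m + n).choose (m + k) : ℤ) * ((m + k).choose m : ℤ)
            = ((m + n).choose m : ℤ) * (n.choose k : ℤ) := by exact_mod_cast e1
        rw [Nat.add_sub_cancel_left]
        linear_combination (-1 : ℤ) ^ k * e2
      simp only [e]
      rw [← Finset.mul_sum, Int.alternating_sum_range_choose]
      by_cases hn : n = 0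
      · simp [hn]
      · simp [hn]
    · intro j hj
      rcases lt_or_ge j m with h' | h'
      · simp [Nat.choose_eq_zero_of_lt h']
      · simp [Nat.choose_eq_zero_of_lt (show m + n < j by omega)]

/-- `∂^i ⊗ a m = ∑_j (i choose j) a^{(i-j)} (∂^j ⊗ m)`. -/
lemma single_smul (a : R) (i : Fin (p + 1)) (m : M) :
    (single R i (a • m) : Prolongation R M p)
      = ∑ j : Fin (p + 1), (((i : ℕ).choose j : R) * iterDeriv ((i : ℕ) - j) a) •
          (single R j m : Prolongation R M p) := by
  simp only [smul_single]
  rw [Finset.sum_comm]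
  simp only [← map_sum, ← Finset.sum_smul]
  have key : ∀ k : Fin (p + 1),
      ∑ j : Fin (p + 1), leftCoeff (((i : ℕ).choose j : R) * iterDeriv ((i : ℕ) - j) a) k j
        = if k = i then a else 0 := by
    intro k
    have e : ∀ j : Fin (p + 1),
        leftCoeff (((i : ℕ).choose j : R) * iterDeriv ((i : ℕ) - j) a) k j
        = ((((i : ℕ).choose j : ℤ) * ((-1) ^ ((j : ℕ) - k) * ((j : ℕ).choose k : ℤ)) : ℤ) : R) *
          iterDeriv ((i : ℕ) - k) a := by
      intro j
      rcases lt_or_ge (j : ℕ) k with h | h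
      · simp [leftCoeff, Nat.choose_eq_zero_of_lt h]
      rcases lt_or_ge (i : ℕ) j with h' | h'
      · simp [leftCoeff, Nat.choose_eq_zero_of_lt h', iterDeriv_zero_right]
      · have := iterDeriv_intCast_mul ((j : ℕ) - k) ((i : ℕ).choose j : ℤ)
          (iterDeriv ((i : ℕ) - j) a)
        rw [iterDeriv_iterDeriv, show (j : ℕ) - k + (i - j) = i - k by omega,
          Int.cast_natCast] at this
        rw [leftCoeff, this]
        push_cast
        ring
    simp only [e]
    rw [← Finset.sum_mul, ← Int.cast_sum, sum_choose_mul_alternating p i k (by omega)]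
    by_cases h : k = i
    · simp [h]
    · simp [h, Fin.val_inj]
  simp only [key]
  rw [Finset.sum_eq_single i]
  · simp
  · intro k _ hk
    simp [hk]
  · simp

/-- The inclusion `V → V^{(p)}`, `v ↦ 1 ⊗ v`. -/
def incl (R : Type*) [CommRing R] [Differential R] (M : Type*) [AddCommGroup M] [Module R M]
    (p : ℕ) : M →ₗ[R] Prolongation R M p where
  toFun m := single R 0 m
  map_add' := map_add _
  map_smul' a m := by
    rw [single_smul, Finset.sum_eq_single 0]
    · simp
    · intro j _ hj
      have : 0 < (j : ℕ) := Nat.pos_of_ne_zero fun h => hj (Fin.ext h)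
      simp [Nat.choose_eq_zero_of_lt this]
    · simp

/-- Functoriality of the prolongation: `∂^i ⊗ m ↦ ∂^i ⊗ f m`. -/
def map {N : Type*} [AddCommGroup N] [Module R N] (p : ℕ) (f : M →ₗ[R] N) :
    Prolongation R M p →ₗ[R] Prolongation R N p where
  toFun x := fun i => f (x i)
  map_add' x y := by
    funext i
    exact map_add f _ _
  map_smul' a x := by
    funext i
    change f ((a • x) i) = ∑ j : Fin (p + 1), leftCoeff a i j • f (x j)
    simp [smul_apply]

lemma map_single {N : Type*} [AddCommGroup N] [Module R N] (f : M →ₗ[R] N) (i : Fin (p + 1))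
    (m : M) : map p f (single R i m) = single R i (f m) := by
  funext k
  change f ((single R i m : Prolongation R M p) k) = (single R i (f m) : Prolongation R N p) k
  simp only [single_apply]
  split_ifs <;> simp

end Module

/-! ### Base change `L ⊗ V^{(p)} ≅ (L ⊗ V)^{(p)}` -/

section BaseChange

set_option linter.unusedSectionVars false

variable (K L V : Type*) [CommRing K] [Differential K] [CommRing L] [Differential L]
  [Algebra K L] [DifferentialAlgebra K L] [AddCommGroup V] [Module K V] (p : ℕ)

lemma leftCoeff_algebraMap (a : K) (k i : ℕ) :
    leftCoeff (algebraMap K L a) k i = algebraMap K L (leftCoeff a k i) := by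
  simp [leftCoeff, iterDeriv_algebraMap]

/-- The `K`-linear map `V^{(p)} → (L ⊗ V)^{(p)}`, `∂^i ⊗ v ↦ ∂^i ⊗ (1 ⊗ v)`. -/
def toBaseChange : Prolongation K V p →+ Prolongation L (L ⊗[K] V) p where
  toFun x := fun i => (1 : L) ⊗ₜ[K] x i
  map_zero' := by
    funext i
    exact TensorProduct.tmul_zero _ _
  map_add' x y := by
    funext i
    exact TensorProduct.tmul_add _ _ _

lemma toBaseChange_smul (a : K) (x : Prolongation K V p) :
    toBaseChange K L V p (a • x) = algebraMap K L a • toBaseChange K L V p x := by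
  funext k
  change (1 : L) ⊗ₜ[K] ((a • x) k) = ∑ i : Fin (p + 1), _ • ((1 : L) ⊗ₜ[K] x i)
  rw [smul_apply, TensorProduct.tmul_sum]
  refine Finset.sum_congr rfl fun i _ => ?_
  rw [leftCoeff_algebraMap, algebraMap_smul, TensorProduct.tmul_smul]

lemma toBaseChange_single (i : Fin (p + 1)) (v : V) :
    toBaseChange K L V p (single K i v) = single L i (1 ⊗ₜ v) := by
  funext k
  change (1 : L) ⊗ₜ[K] ((single K i v : Prolongation K V p) k) = _
  simp only [single_apply]
  split_ifs <;> simp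

/-- `l ⊗ x ↦ l • x`, as an additive map `L ⊗ V^{(p)} → (L ⊗ V)^{(p)}`. -/
noncomputable def baseChangeHom :
    L ⊗[K] Prolongation K V p →+ Prolongation L (L ⊗[K] V) p :=
  TensorProduct.liftAddHom
    { toFun := fun l => (DistribSMul.toAddMonoidHom _ l).comp (toBaseChange K L V p)
      map_zero' := by
        ext x
        exact zero_smul L (toBaseChange K L V p x)
      map_add' := fun l l' => by
        ext x
        exact add_smul l l' (toBaseChange K L V p x) }
    (fun a l x => by
      simp only [AddMonoidHom.coe_mk, ZeroHom.coe_mk, AddMonoidHom.comp_apply,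
        DistribSMul.toAddMonoidHom_apply, toBaseChange_smul, smul_smul]
      rw [Algebra.smul_def, mul_comm])

lemma baseChangeHom_tmul (l : L) (x : Prolongation K V p) :
    baseChangeHom K L V p (l ⊗ₜ x) = l • toBaseChange K L V p x := rfl

lemma choose_iterDeriv_mul (a l : L) (p i k : ℕ) (hi : i ≤ p) :
    (i.choose k : L) * iterDeriv (i - k) (a * l) = ∑ j : Fin (p + 1),
      ((i.choose j : L) * iterDeriv (i - j) l) * (((j : ℕ).choose k : L) *
        iterDeriv ((j : ℕ) - k) a) := by
  rcases lt_or_ge i k with h | h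
  · rw [Nat.choose_eq_zero_of_lt h, Nat.cast_zero, zero_mul]
    symm
    refine Finset.sum_eq_zero fun j _ => ?_
    rcases lt_or_ge (j : ℕ) k with h' | h'
    · simp [Nat.choose_eq_zero_of_lt h']
    · simp [Nat.choose_eq_zero_of_lt (show i < (j : ℕ) by omega)]
  · obtain ⟨n, rfl⟩ := Nat.exists_eq_add_of_le h
    rw [sum_window p k n hi (fun j => (((k + n).choose j : L) * iterDeriv (k + n - j) l) *
      ((j.choose k : L) * iterDeriv (j - k) a))]
    · rw [Nat.add_sub_cancel_left, iterDeriv_mul, Finset.mul_sum]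
      refine Finset.sum_congr rfl fun m hm => ?_
      have e : (k + n).choose (k + m) * (k + m).choose k = (k + n).choose k * n.choose m := by
        rw [Nat.choose_mul (by omega)]
        congr 2 <;> omega
      have e' : (((k + n).choose (k + m) : L)) * ((k + m).choose k : L)
          = ((k + n).choose k : L) * (n.choose m : L) := by
        exact_mod_cast congrArg (Nat.cast (R := L)) e
      rw [Nat.add_sub_cancel_left, Nat.add_sub_add_left]
      linear_combination -(iterDeriv m a * iterDeriv (n - m) l) * e'
    · intro j hj
      rcases lt_or_ge j k with h' | h'
      · simp [Nat.choose_eq_zero_of_lt h']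
      · simp [Nat.choose_eq_zero_of_lt (show k + n < j by omega)]

/-- `∂^i ⊗ (l ⊗ v) ↦ ∑_j (i choose j) l^{(i-j)} ⊗ (∂^j ⊗ v)`. -/
noncomputable def baseChangeInvAux (i : Fin (p + 1)) :
    L ⊗[K] V →+ L ⊗[K] Prolongation K V p :=
  TensorProduct.liftAddHom
    { toFun := fun l => ∑ j : Fin (p + 1),
        ((TensorProduct.mk K L (Prolongation K V p)
          (((i : ℕ).choose j : L) * iterDeriv ((i : ℕ) - j) l)).toAddMonoidHom).comp (single K j)
      map_zero' := by
        ext v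
        simp [iterDeriv_zero_right]
      map_add' := fun l l' => by
        ext v
        simp [iterDeriv_add, mul_add, Finset.sum_add_distrib] }
    (fun a l v => by
      simp only [AddMonoidHom.coe_mk, ZeroHom.coe_mk, AddMonoidHom.finsetSum_apply,
        AddMonoidHom.comp_apply, LinearMap.toAddMonoidHom_coe, TensorProduct.mk_apply,
        single_smul, TensorProduct.tmul_sum, ← TensorProduct.smul_tmul]
      rw [Finset.sum_comm]
      refine Finset.sum_congr rfl fun k _ => ?_
      rw [← TensorProduct.sum_tmul, Algebra.smul_def, choose_iterDeriv_mul L _ _ p _ _ (by omega)]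
      congr 1
      refine Finset.sum_congr rfl fun j _ => ?_
      rw [iterDeriv_algebraMap, Algebra.smul_def]
      simp
      ring)

lemma baseChangeInvAux_tmul (i : Fin (p + 1)) (l : L) (v : V) :
    baseChangeInvAux K L V p i (l ⊗ₜ v) = ∑ j : Fin (p + 1),
      (((i : ℕ).choose j : L) * iterDeriv ((i : ℕ) - j) l) ⊗ₜ[K] single K j v := by
  change (∑ j : Fin (p + 1), _ : V →+ L ⊗[K] Prolongation K V p) v = _
  simp

/-- The inverse of `baseChangeHom`. -/
noncomputable def baseChangeInv :
    Prolongation L (L ⊗[K] V) p →+ L ⊗[K] Prolongation K V p where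
  toFun x := ∑ i, baseChangeInvAux K L V p i (x i)
  map_zero' := Finset.sum_eq_zero fun i _ => map_zero _
  map_add' x y := by
    rw [← Finset.sum_add_distrib]
    exact Finset.sum_congr rfl fun i _ => map_add _ _ _

lemma baseChangeInv_single (i : Fin (p + 1)) (m : L ⊗[K] V) :
    baseChangeInv K L V p (single L i m) = baseChangeInvAux K L V p i m := by
  change ∑ k, baseChangeInvAux K L V p k ((single L i m : Prolongation L (L ⊗[K] V) p) k) = _
  rw [Finset.sum_eq_single i]
  · simp [single_apply]
  · intro k _ hk
    simp [single_apply, hk]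
  · simp

lemma baseChange_left_inv (y : L ⊗[K] Prolongation K V p) :
    baseChangeInv K L V p (baseChangeHom K L V p y) = y := by
  induction y with
  | zero => simp
  | add a b ha hb => rw [map_add, map_add, ha, hb]
  | tmul l x =>
    rw [← sum_single x, TensorProduct.tmul_sum, map_sum, map_sum]
    refine Finset.sum_congr rfl fun i _ => ?_
    rw [baseChangeHom_tmul, toBaseChange_single, smul_single, map_sum]
    simp only [baseChangeInv_single, TensorProduct.smul_tmul', smul_eq_mul, mul_one,
      baseChangeInvAux_tmul]
    rw [Finset.sum_comm]
    simp only [← TensorProduct.sum_tmul]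
    have key : ∀ j : Fin (p + 1), ∑ k : Fin (p + 1),
        ((k : ℕ).choose j : L) * iterDeriv ((k : ℕ) - j) (leftCoeff l k i)
          = if j = i then l else 0 := by
      intro j
      have e : ∀ k : Fin (p + 1),
          ((k : ℕ).choose j : L) * iterDeriv ((k : ℕ) - j) (leftCoeff l k i)
          = ((((i : ℕ).choose k : ℤ) * ((-1) ^ ((k : ℕ) - j) * ((k : ℕ).choose j : ℤ)) : ℤ) : L) *
            ((-1) ^ ((i : ℕ) - j) * iterDeriv ((i : ℕ) - j) l) := by
        intro k
        rcases lt_or_ge (k : ℕ) j with h | h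
        · simp [Nat.choose_eq_zero_of_lt h]
        rcases lt_or_ge (i : ℕ) k with h' | h'
        · simp [leftCoeff, Nat.choose_eq_zero_of_lt h', iterDeriv_zero_right]
        · rw [leftCoeff, iterDeriv_intCast_mul, iterDeriv_iterDeriv,
            show (k : ℕ) - j + (i - k) = i - j by omega]
          have s : ((-1 : L)) ^ ((i : ℕ) - k) = (-1) ^ ((k : ℕ) - j) * (-1) ^ ((i : ℕ) - j) := by
            rw [← pow_add, show (k : ℕ) - j + (i - j) = (i - k) + 2 * (k - j) by omega,
              pow_add, pow_mul]
            simp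
          push_cast
          rw [s]
          ring
      simp only [e]
      rw [← Finset.sum_mul, ← Int.cast_sum, sum_choose_mul_alternating p i j (by omega)]
      by_cases h : j = i
      · simp [h]
      · simp [h, Fin.val_inj]
    simp only [key]
    rw [Finset.sum_eq_single i]
    · simp
    · intro k _ hk
      simp [hk]
    · simp

lemma baseChange_right_inv (x : Prolongation L (L ⊗[K] V) p) :
    baseChangeHom K L V p (baseChangeInv K L V p x) = x := by
  rw [← sum_single x, map_sum, map_sum]
  refine Finset.sum_congr rfl fun i _ => ?_
  rw [baseChangeInv_single]
  induction x i with
  | zero => simp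
  | add a b ha hb => rw [map_add, map_add, ha, hb, map_add]
  | tmul l v =>
    have : l ⊗ₜ[K] v = l • ((1 : L) ⊗ₜ[K] v) := by simp [TensorProduct.smul_tmul']
    rw [baseChangeInvAux_tmul, map_sum, this, single_smul]
    simp only [baseChangeHom_tmul, toBaseChange_single]

/-- The canonical isomorphism `L ⊗ V^{(p)} ≃ (L ⊗ V)^{(p)}`,
`l ⊗ (∂^i ⊗ v) ↦ l • (∂^i ⊗ (1 ⊗ v))`. -/
noncomputable def baseChangeEquiv :
    L ⊗[K] Prolongation K V p ≃ₗ[L] Prolongation L (L ⊗[K] V) p where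
  toFun := baseChangeHom K L V p
  invFun := baseChangeInv K L V p
  left_inv := baseChange_left_inv K L V p
  right_inv := baseChange_right_inv K L V p
  map_add' := map_add _
  map_smul' a y := by
    induction y with
    | zero => simp
    | add x y hx hy => rw [smul_add, map_add, hx, hy, map_add, smul_add]
    | tmul l x =>
      simp [TensorProduct.smul_tmul', baseChangeHom_tmul, mul_smul]

end BaseChange

end Prolongation

/-! ### Linear differential algebraic groups and their representations -/

section Groups

open Matrix

variable {K Kbar U V ι : Type*} [Field K] [Differential K] [Field Kbar] [Differential Kbar]
  [Field U] [Differential U] [Algebra K Kbar] [Algebra K U] [Algebra Kbar U]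
  [AddCommGroup V] [Module K V]

/-- The matrix of `g ∈ GL(V)(U) = GL_U(U ⊗ V)` with respect to a `K`-basis of `V`. -/
noncomputable def toMatrixGL [Fintype ι] [DecidableEq ι] (b : Module.Basis ι K V) :
    LinearMap.GeneralLinearGroup U (U ⊗[K] V) →* GL ι U :=
  Units.map (LinearMap.toMatrixAlgEquiv (b.baseChange U)).toMonoidHom

/-- `G ⊆ GL(V)(U)` is Kolchin closed over `K`: it is the set of invertible maps whose matrix
entries satisfy a system of differential polynomial equations with coefficients in `K`. -/
def IsKolchinClosed [Fintype ι] [DecidableEq ι] (b : Module.Basis ι K V)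
    (G : Set (LinearMap.GeneralLinearGroup U (U ⊗[K] V))) : Prop :=
  ∃ S : Set (MvPolynomial ((ι × ι) × ℕ) K), ∀ g, g ∈ G ↔
    ∀ f ∈ S, diffEval (fun ij : ι × ι => (toMatrixGL b g : Matrix ι ι U) ij.1 ij.2) f = 0

/-- `G` is conjugate over `Kbar` to a group `H` of constant matrices. -/
def IsConjugateToConstants (Kbar : Type*) [Field Kbar] [Algebra Kbar U]
    [Fintype ι] [DecidableEq ι] (b : Module.Basis ι K V)
    (G : Subgroup (LinearMap.GeneralLinearGroup U (U ⊗[K] V))) : Prop :=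
  ∃ (D : GL ι Kbar) (H : Subgroup (GL ι (constants U))),
    (fun g => (GeneralLinearGroup.map (algebraMap Kbar U) D)⁻¹ * toMatrixGL b g *
        GeneralLinearGroup.map (algebraMap Kbar U) D) '' (G : Set _)
      = GeneralLinearGroup.map (constants U).subtype '' (H : Set (GL ι (constants U)))

/-- The action of `g ∈ GL(V)(U)` on `U ⊗ V^{(p)} = (U ⊗ V)^{(p)}`:
`g (∂^i ⊗ w) = ∂^i ⊗ g w` for `w ∈ U ⊗ V`. -/
noncomputable def prolongAct [DifferentialAlgebra K U] (p : ℕ)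
    (g : LinearMap.GeneralLinearGroup U (U ⊗[K] V)) :
    U ⊗[K] Prolongation K V p →ₗ[U] U ⊗[K] Prolongation K V p :=
  (Prolongation.baseChangeEquiv K U V p).symm.toLinearMap ∘ₗ
    Prolongation.map p (g : U ⊗[K] V →ₗ[U] U ⊗[K] V) ∘ₗ
      (Prolongation.baseChangeEquiv K U V p).toLinearMap

/-- The diagonal action of `g ∈ GL(V)(U)` on `U ⊗ (V ⊕ V_1 ⊕ ⋯ ⊕ V_p)`, where each `V_i` is a
copy of `V`. -/
noncomputable def directSumAct (p : ℕ) (g : LinearMap.GeneralLinearGroup U (U ⊗[K] V)) :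
    U ⊗[K] (Fin (p + 1) → V) →ₗ[U] U ⊗[K] (Fin (p + 1) → V) :=
  (TensorProduct.piRight K U U (fun _ : Fin (p + 1) => V)).symm.toLinearMap ∘ₗ
    LinearMap.pi (fun i => (g : U ⊗[K] V →ₗ[U] U ⊗[K] V) ∘ₗ LinearMap.proj i) ∘ₗ
      (TensorProduct.piRight K U U (fun _ : Fin (p + 1) => V)).toLinearMap

/-- The extension of scalars `U ⊗_K X → U ⊗_K Y` of a `Kbar`-linear map
`Kbar ⊗_K X → Kbar ⊗_K Y`. -/
noncomputable def extendToU [IsScalarTower K Kbar U]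
    {X Y : Type*} [AddCommGroup X] [Module K X] [AddCommGroup Y] [Module K Y]
    (φ : Kbar ⊗[K] X →ₗ[Kbar] Kbar ⊗[K] Y) : U ⊗[K] X →ₗ[U] U ⊗[K] Y :=
  (TensorProduct.AlgebraTensorModule.cancelBaseChange K Kbar U U Y).toLinearMap ∘ₗ
    φ.baseChange U ∘ₗ
      (TensorProduct.AlgebraTensorModule.cancelBaseChange K Kbar U U X).symm.toLinearMap

/-- `φ : Kbar ⊗ (V ⊕ V_1 ⊕ ⋯ ⊕ V_p) → Kbar ⊗ V^{(p)}` is `G`-equivariant. -/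
def IsEquivariant [DifferentialAlgebra K U] [IsScalarTower K Kbar U]
    (G : Subgroup (LinearMap.GeneralLinearGroup U (U ⊗[K] V))) (p : ℕ)
    (φ : Kbar ⊗[K] (Fin (p + 1) → V) →ₗ[Kbar] Kbar ⊗[K] Prolongation K V p) : Prop :=
  ∀ g ∈ G, extendToU (U := U) φ ∘ₗ directSumAct p g = prolongAct p g ∘ₗ extendToU (U := U) φ

end Groups

end DiffAlg

/-! ### Derivations on rational function fields and linear systems `D' = B D` -/

namespace DiffAlg

/-! From constants to isomorphisms. If `D` conjugates `G` into constant matrices, the columns of `D`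
form a basis `e` of `Kbar ⊗ V` on which `G` acts, over `U`, by constant matrices. Constants commute
with `∂`, so the `∂^i ⊗ e_j` with `i` fixed transform exactly as the `e_j` do, and sending `e_j` in
the `i`-th summand to `∂^i ⊗ e_j` is equivariant. This map is bijective, being triangular with
respect to the order of `∂`, and for `i = 0` it is the canonical inclusion. Thus condition 1 gives
condition 3, and so condition 2 (`exists_equiv_of_isConjugateToConstants`).

Back to constants, only `p = 1` is needed, and no normalisation of the isomorphism. There is an
equivariant exact sequence `0 → V → V^{(1)} → V → 0`, whose second map takes the coefficient of `∂`.
If the middle term is abstractly `V ⊕ V` over `Kbar`, the sequence splits by counting dimensions.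
Write `Hom_G` for equivariant maps over `Kbar`: `Hom_G(V, V^{(1)})` has dimension at least `2 dim
End_G(V)`, and those maps killed by the projection form a space of dimension at most `dim End_G(V)`.
So composition with the projection is onto `End_G(V)`, and the identity lifts (`exists_section_mem`,
`exists_equivariant_section`).

A section has the form `b_j ↦ ∂ ⊗ b_j + 1 ⊗ ∑ B_kj b_k`, and its equivariance says `A' = B A - A B`
for every matrix `A` of `G` (`exists_connection`). A differentially closed field contains an
invertible solution of `D' = B D` (`exists_fundamental_matrix`), and differentiation shows that `D⁻¹
A D` is constant (`map_deriv_conj_eq_zero`). -/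

/-- A ring homomorphism `E → E[ε]` lifting the identity defines a derivation of `E`. -/
def derivationOfDual {E : Type*} [CommRing E] (f : E →+* TrivSqZeroExt E E)
    (hf : ∀ x, (f x).fst = x) : Derivation ℤ E E :=
  Derivation.mk' ((TrivSqZeroExt.sndHom E E).toAddMonoidHom.comp f.toAddMonoidHom).toIntLinearMap
    (fun a b => by
      change (f (a * b)).snd = a • (f b).snd + b • (f a).snd
      rw [map_mul, TrivSqZeroExt.snd_mul, hf, hf, op_smul_eq_smul])

/-- The ring homomorphism `a ↦ a + a'ε` attached to a derivation `F → E`. -/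
def dualOfDeriv (F E : Type*) [CommRing F] [Differential F] [CommRing E] [Algebra F E] :
    F →+* TrivSqZeroExt E E where
  toFun a := (algebraMap F E a, algebraMap F E (a′))
  map_one' := TrivSqZeroExt.ext (map_one _) (by
    change algebraMap F E ((1 : F)′) = 0
    simp)
  map_mul' a b := TrivSqZeroExt.ext (map_mul _ a b) (by
    change algebraMap F E ((a * b)′) = algebraMap F E a • algebraMap F E (b′) +
      MulOpposite.op (algebraMap F E b) • algebraMap F E (a′)
    simp [Derivation.leibniz, mul_comm])
  map_zero' := TrivSqZeroExt.ext (map_zero _) (by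
    change algebraMap F E ((0 : F)′) = 0
    simp)
  map_add' a b := TrivSqZeroExt.ext (map_add _ a b) (by
    change algebraMap F E ((a + b)′) = algebraMap F E (a′) + algebraMap F E (b′)
    simp)

@[simp] lemma fst_dualOfDeriv {F E : Type*} [CommRing F] [Differential F] [CommRing E]
    [Algebra F E] (a : F) : (dualOfDeriv F E a).fst = algebraMap F E a := rfl

@[simp] lemma snd_dualOfDeriv {F E : Type*} [CommRing F] [Differential F] [CommRing E]
    [Algebra F E] (a : F) : (dualOfDeriv F E a).snd = algebraMap F E (a′) := rfl

section Linear

open MvPolynomial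

variable {σ F : Type*} [Field F] [Differential F]

/-- The ring homomorphism from `Frac F[x_s]` to its dual numbers with `a ↦ a + a'ε` on `F`
and `x_s ↦ x_s + w_s ε`. -/
noncomputable def fractionDual (w : σ → FractionRing (MvPolynomial σ F)) :
    FractionRing (MvPolynomial σ F) →+*
      TrivSqZeroExt (FractionRing (MvPolynomial σ F)) (FractionRing (MvPolynomial σ F)) :=
  IsLocalization.lift (M := nonZeroDivisors (MvPolynomial σ F))
    (g := eval₂Hom (dualOfDeriv F (FractionRing (MvPolynomial σ F)))
      (fun s => TrivSqZeroExt.inl (algebraMap (MvPolynomial σ F) _ (X s)) + TrivSqZeroExt.inr (w s)))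
    (fun y => by
      -- A dual number is invertible as soon as its first component is, and the first component of
      -- the image of a polynomial is that polynomial.
      rw [TrivSqZeroExt.isUnit_iff_isUnit_fst]
      have h : ((TrivSqZeroExt.fstHom F (FractionRing (MvPolynomial σ F))
            (FractionRing (MvPolynomial σ F))).toRingHom.comp
          (eval₂Hom (dualOfDeriv F (FractionRing (MvPolynomial σ F)))
            (fun s => TrivSqZeroExt.inl (algebraMap (MvPolynomial σ F) _ (X s)) + TrivSqZeroExt.inr (w s))))
          = algebraMap (MvPolynomial σ F) (FractionRing (MvPolynomial σ F)) := by
        refine MvPolynomial.ringHom_ext (fun a => ?_) (fun s => ?_)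
        · simp [IsScalarTower.algebraMap_apply F (MvPolynomial σ F)
            (FractionRing (MvPolynomial σ F))]
        · simp
      have h' := RingHom.congr_fun h (y : MvPolynomial σ F)
      change TrivSqZeroExt.fst _ = _ at h'
      rw [h']
      exact IsLocalization.map_units _ y)

lemma fractionDual_X (w : σ → FractionRing (MvPolynomial σ F)) (s : σ) :
    fractionDual w (algebraMap (MvPolynomial σ F) _ (X s)) =
      TrivSqZeroExt.inl (algebraMap (MvPolynomial σ F) _ (X s)) + TrivSqZeroExt.inr (w s) := by
  simp [fractionDual]

lemma fractionDual_algebraMap (w : σ → FractionRing (MvPolynomial σ F)) (a : F) :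
    fractionDual w (algebraMap F _ a) = dualOfDeriv F _ a := by
  rw [IsScalarTower.algebraMap_apply F (MvPolynomial σ F), fractionDual, IsLocalization.lift_eq]
  simp [MvPolynomial.algebraMap_eq]

/-- Needed for the `ε`-component of `fractionDual` to be a derivation. It suffices to compare on
coefficients and variables. -/
lemma fst_fractionDual (w : σ → FractionRing (MvPolynomial σ F))
    (x : FractionRing (MvPolynomial σ F)) : (fractionDual w x).fst = x := by
  have h : ((TrivSqZeroExt.fstHom F (FractionRing (MvPolynomial σ F))
      (FractionRing (MvPolynomial σ F))).toRingHom.comp (fractionDual w)) = RingHom.id _ := by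
    refine IsLocalization.ringHom_ext (nonZeroDivisors (MvPolynomial σ F)) ?_
    refine MvPolynomial.ringHom_ext (fun a => ?_) (fun s => ?_)
    · change (fractionDual w (algebraMap (MvPolynomial σ F) _ (C a))).fst = algebraMap (MvPolynomial σ F) _ (C a)
      have := fractionDual_algebraMap w a
      rw [IsScalarTower.algebraMap_apply F (MvPolynomial σ F), MvPolynomial.algebraMap_eq] at this
      rw [this]
      simp [IsScalarTower.algebraMap_apply F (MvPolynomial σ F)
            (FractionRing (MvPolynomial σ F))]
    · change (fractionDual w (algebraMap (MvPolynomial σ F) _ (X s))).fst = algebraMap (MvPolynomial σ F) _ (X s)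
      rw [fractionDual_X]
      simp
  exact RingHom.congr_fun h x

/-- Over a differentially closed field every linear system `D' = B D` has an invertible
solution. -/
theorem IsDifferentiallyClosed.exists_fundamental_matrix {ι : Type*} [Fintype ι] [DecidableEq ι]
    (hF : IsDifferentiallyClosed F) (B : Matrix ι ι F) :
    ∃ D : GL ι F, (D : Matrix ι ι F).map (fun x => x′) = B * (D : Matrix ι ι F) := by
  classical
  let n := Fintype.card (ι × ι)
  let e : ι × ι ≃ Fin n := Fintype.equivFin _
  let E := FractionRing (MvPolynomial (Fin n) F)
  let x : Fin n → E := fun s => algebraMap (MvPolynomial (Fin n) F) E (X s)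
  -- The entries of `B X` for the generic matrix `X`: prescribing them as derivatives of the
  -- variables makes `X` a solution over `E`.
  let w : Fin n → E := fun s =>
    ∑ k, algebraMap F E (B (e.symm s).1 k) * x (e (k, (e.symm s).2))
  let _ : Differential E := ⟨derivationOfDual (fractionDual w) (fst_fractionDual w)⟩
  have hd (y : E) : y′ = (fractionDual w y).snd := rfl
  have _ : DifferentialAlgebra F E := ⟨fun a => by
    rw [hd, fractionDual_algebraMap, snd_dualOfDeriv]⟩
  let eqn : ι × ι → MvPolynomial (Fin n × ℕ) F := fun ij =>
    X (e ij, 1) - ∑ k, C (B ij.1 k) * X (e (k, ij.2), 0)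
  let M : Matrix ι ι (MvPolynomial (Fin n × ℕ) F) := Matrix.of fun i j => X (e (i, j), 0)
  have hM {A : Type _} [Field A] [Differential A] [Algebra F A] (y : Fin n → A) :
      diffEval y M.det = (Matrix.of fun i j => y (e (i, j))).det := by
    rw [diffEval, AlgHom.map_det]
    congr 1
    ext i j
    simp [M]
  have heq {A : Type _} [Field A] [Differential A] [Algebra F A] (y : Fin n → A) (ij : ι × ι) :
      diffEval y (eqn ij) = (y (e ij))′ - ∑ k, algebraMap F A (B ij.1 k) * y (e (k, ij.2)) := by
    simp [diffEval, eqn, iterDeriv_succ, MvPolynomial.algHom_C]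
  -- The generic matrix solves the system in `E` with nonzero determinant, so differential
  -- closedness yields a solution in `F`; the inequation `det ≠ 0` keeps it invertible.
  obtain ⟨y, hy, hy'⟩ := hF E n (Finset.univ.image eqn) M.det ⟨x, by
    intro f hf
    obtain ⟨ij, -, rfl⟩ := Finset.mem_image.1 hf
    rw [heq, hd]
    have h := congrArg TrivSqZeroExt.snd (fractionDual_X w (e ij))
    rw [TrivSqZeroExt.snd_add, TrivSqZeroExt.snd_inl, TrivSqZeroExt.snd_inr, zero_add] at h
    rw [h]
    simp [w], by
    rw [hM]
    have h : (Matrix.of fun i j => x (e (i, j)))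
        = ((Matrix.mvPolynomialX ι ι F).map (rename e)).map (algebraMap _ E) := by
      ext i j
      simp [x]
    rw [h, ← RingHom.mapMatrix_apply, ← RingHom.map_det, ← AlgHom.mapMatrix_apply,
      ← AlgHom.map_det]
    intro h0
    have h1 := (IsFractionRing.injective (MvPolynomial (Fin n) F) E) (h0.trans (map_zero _).symm)
    have h2 := rename_injective e e.injective (h1.trans (map_zero _).symm)
    exact Matrix.det_mvPolynomialX_ne_zero ι F h2⟩
  rw [hM] at hy'
  refine ⟨Matrix.GeneralLinearGroup.mkOfDetNeZero _ hy', ?_⟩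
  ext i j
  have := hy (eqn (i, j)) (Finset.mem_image_of_mem _ (Finset.mem_univ _))
  rw [heq, sub_eq_zero] at this
  simpa [Matrix.mul_apply, Matrix.GeneralLinearGroup.mkOfDetNeZero] using this

end Linear

end DiffAlg

/-! ### Splitting an exact sequence by counting dimensions -/

namespace DiffAlg

/-- A dimension count: let `A` be a space of endomorphisms of `P` and `E` a space of maps
`P → Q` closed under the relevant compositions. If `E` contains `j₀ A ⊕ j₁ A` and the elements of
`E` killed by `π` lie in `i A`, then `π` has a section in `E`. -/
lemma exists_section_mem {k P Q : Type*} [Field k] [AddCommGroup P] [Module k P]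
    [Module.Finite k P] [AddCommGroup Q] [Module k Q] [Module.Finite k Q]
    {A : Submodule k (P →ₗ[k] P)} {E : Submodule k (P →ₗ[k] Q)} (hA : LinearMap.id ∈ A)
    {i j₀ j₁ : P →ₗ[k] Q} {π q₀ q₁ : Q →ₗ[k] P} (hi : ∀ f ∈ A, i ∘ₗ f ∈ E)
    (hπ : ∀ f ∈ E, π ∘ₗ f ∈ A) (hj₀ : ∀ f ∈ A, j₀ ∘ₗ f ∈ E) (hj₁ : ∀ f ∈ A, j₁ ∘ₗ f ∈ E)
    (h₀₀ : q₀ ∘ₗ j₀ = LinearMap.id) (h₀₁ : q₀ ∘ₗ j₁ = 0) (h₁₀ : q₁ ∘ₗ j₀ = 0)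
    (h₁₁ : q₁ ∘ₗ j₁ = LinearMap.id)
    (hker : ∀ f ∈ E, π ∘ₗ f = 0 → ∃ f' ∈ A, i ∘ₗ f' = f) :
    ∃ s ∈ E, π ∘ₗ s = LinearMap.id := by
  let iA : A →ₗ[k] E := (LinearMap.compRight k i).restrict hi
  let πE : E →ₗ[k] A := (LinearMap.compRight k π).restrict hπ
  let α₀ : A →ₗ[k] E := (LinearMap.compRight k j₀).restrict hj₀
  let α₁ : A →ₗ[k] E := (LinearMap.compRight k j₁).restrict hj₁
  have h : Function.Injective (α₀.coprod α₁) := by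
    rw [← LinearMap.ker_eq_bot, LinearMap.ker_eq_bot']
    rintro ⟨f, g⟩ h
    have h1 : j₀ ∘ₗ f.1 + j₁ ∘ₗ g.1 = 0 := congrArg Subtype.val h
    refine Prod.ext (Subtype.ext ?_) (Subtype.ext ?_)
    · simpa [LinearMap.comp_add, ← LinearMap.comp_assoc, h₀₀, h₀₁] using
        congrArg (fun c => q₀ ∘ₗ c) h1
    · simpa [LinearMap.comp_add, ← LinearMap.comp_assoc, h₁₀, h₁₁] using
        congrArg (fun c => q₁ ∘ₗ c) h1
  have hker' : LinearMap.ker πE ≤ LinearMap.range iA := by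
    rintro ⟨f, hf⟩ h
    obtain ⟨f', hf', rfl⟩ := hker f hf (congrArg Subtype.val h)
    exact ⟨⟨f', hf'⟩, rfl⟩
  have h1 := LinearMap.finrank_le_finrank_of_injective h
  have h2 := (Submodule.finrank_mono hker').trans (LinearMap.finrank_range_le iA)
  have h3 := πE.finrank_range_add_finrank_ker
  rw [Module.finrank_prod] at h1
  have h4 := Submodule.finrank_le (LinearMap.range πE)
  -- `2 dim A ≤ dim E = rank πE + dim ker πE ≤ rank πE + dim A`, so the rank is at least `dim A`.
  have h5 : LinearMap.range πE = ⊤ := Submodule.eq_top_of_finrank_eq (by omega)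
  obtain ⟨s, hs⟩ := LinearMap.range_eq_top.1 h5 ⟨LinearMap.id, hA⟩
  exact ⟨s.1, s.2, congrArg Subtype.val hs⟩

/-! ### Maps over `Kbar` that are equivariant over `U` -/

section ExtendScalars

variable {K Kbar : Type*} (U : Type*) [Field K] [Field Kbar] [Field U] [Algebra K Kbar]
  [Algebra K U] [Algebra Kbar U] [IsScalarTower K Kbar U]
  {X Y Z : Type*} [AddCommGroup X] [Module K X] [AddCommGroup Y] [Module K Y]
  [AddCommGroup Z] [Module K Z]

/-- The canonical map `Kbar ⊗ X → U ⊗ X`. -/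
noncomputable def toU (X : Type*) [AddCommGroup X] [Module K X] :
    Kbar ⊗[K] X →ₗ[Kbar] U ⊗[K] X :=
  TensorProduct.AlgebraTensorModule.map (Algebra.linearMap Kbar U) LinearMap.id

@[simp] lemma toU_tmul (c : Kbar) (x : X) : toU U X (c ⊗ₜ[K] x) = algebraMap Kbar U c ⊗ₜ x := rfl

lemma toU_smul (c : Kbar) (y : Kbar ⊗[K] X) : toU U X (c • y) = algebraMap Kbar U c • toU U X y := by
  rw [map_smul, algebraMap_smul]

variable (Kbar) in
/-- Maps out of `U ⊗ X` are determined by their restriction to `Kbar ⊗ X`. -/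
lemma ext_toU {N : Type*} [AddCommGroup N] [Module U N] {f g : U ⊗[K] X →ₗ[U] N}
    (h : ∀ y : Kbar ⊗[K] X, f (toU U X y) = g (toU U X y)) : f = g := by
  ext1 z
  induction z with
  | zero => simp
  | add a b ha hb => rw [map_add, map_add, ha, hb]
  | tmul u x =>
    have hx : u ⊗ₜ[K] x = u • toU U X ((1 : Kbar) ⊗ₜ[K] x) := by
      simp [TensorProduct.smul_tmul']
    rw [hx, map_smul, map_smul, h]

variable {U}

/-- Together with `ext_toU` this characterises `extendToU`, so the formal properties below can be
checked on `Kbar ⊗ X`. -/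
lemma extendToU_toU (φ : Kbar ⊗[K] X →ₗ[Kbar] Kbar ⊗[K] Y) (y : Kbar ⊗[K] X) :
    extendToU φ (toU U X y) = toU U Y (φ y) := by
  have h : ∀ {X : Type _} [AddCommGroup X] [Module K X] (y : Kbar ⊗[K] X),
      TensorProduct.AlgebraTensorModule.cancelBaseChange K Kbar U U X (1 ⊗ₜ[Kbar] y)
        = toU U X y := by
    intro X _ _ y
    induction y with
    | zero => simp
    | add a b ha hb => rw [TensorProduct.tmul_add, map_add, ha, hb, map_add]
    | tmul c x =>
      rw [TensorProduct.AlgebraTensorModule.cancelBaseChange_tmul, toU_tmul,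
        Algebra.algebraMap_eq_smul_one]
  have h' : (TensorProduct.AlgebraTensorModule.cancelBaseChange K Kbar U U X).symm (toU U X y)
      = 1 ⊗ₜ[Kbar] y := by
    rw [LinearEquiv.symm_apply_eq]
    induction y with
    | zero => simp
    | add a b ha hb => rw [TensorProduct.tmul_add, map_add, ha, hb, map_add]
    | tmul c x =>
      rw [TensorProduct.AlgebraTensorModule.cancelBaseChange_tmul, toU_tmul,
        Algebra.algebraMap_eq_smul_one]
  rw [extendToU, LinearMap.comp_apply, LinearMap.comp_apply, LinearEquiv.coe_coe,
    LinearEquiv.coe_coe, h', LinearMap.baseChange_tmul, h]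

lemma extendToU_comp (ψ : Kbar ⊗[K] Y →ₗ[Kbar] Kbar ⊗[K] Z)
    (φ : Kbar ⊗[K] X →ₗ[Kbar] Kbar ⊗[K] Y) :
    extendToU (U := U) (ψ ∘ₗ φ) = extendToU ψ ∘ₗ extendToU φ :=
  ext_toU Kbar U fun y => by simp [extendToU_toU]

lemma extendToU_add (φ ψ : Kbar ⊗[K] X →ₗ[Kbar] Kbar ⊗[K] Y) :
    extendToU (U := U) (φ + ψ) = extendToU φ + extendToU ψ :=
  ext_toU Kbar U fun y => by simp [extendToU_toU]

lemma extendToU_smul (c : Kbar) (φ : Kbar ⊗[K] X →ₗ[Kbar] Kbar ⊗[K] Y) :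
    extendToU (U := U) (c • φ) = algebraMap Kbar U c • extendToU φ :=
  ext_toU Kbar U fun y => by
    rw [extendToU_toU, LinearMap.smul_apply, LinearMap.smul_apply, toU_smul, extendToU_toU]

lemma extendToU_baseChange (f : X →ₗ[K] Y) :
    extendToU (U := U) (f.baseChange Kbar) = f.baseChange U :=
  ext_toU Kbar U fun y => by
    rw [extendToU_toU]
    induction y with
    | zero => simp
    | add a b ha hb => simp only [map_add, ha, hb]
    | tmul c x => simp

variable {Γ : Type*}

/-- The space of `Γ`-equivariant `Kbar`-linear maps `Kbar ⊗ X → Kbar ⊗ Y`, where `Γ` acts on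
`U ⊗ X` and `U ⊗ Y`. -/
def equivariantHom (Kbar : Type*) [Field Kbar] [Algebra K Kbar] [Algebra Kbar U]
    [IsScalarTower K Kbar U] (ρ : Γ → U ⊗[K] X →ₗ[U] U ⊗[K] X)
    (σ : Γ → U ⊗[K] Y →ₗ[U] U ⊗[K] Y) :
    Submodule Kbar (Kbar ⊗[K] X →ₗ[Kbar] Kbar ⊗[K] Y) where
  carrier := {φ | ∀ g, extendToU φ ∘ₗ ρ g = σ g ∘ₗ extendToU φ}
  add_mem' {φ ψ} hφ hψ g := by
    rw [extendToU_add, LinearMap.add_comp, LinearMap.comp_add, hφ g, hψ g]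
  zero_mem' g := by
    have : extendToU (U := U) (0 : Kbar ⊗[K] X →ₗ[Kbar] Kbar ⊗[K] Y) = 0 :=
      ext_toU Kbar U fun y => by simp [extendToU_toU]
    rw [this, LinearMap.zero_comp, LinearMap.comp_zero]
  smul_mem' c φ hφ g := by
    rw [extendToU_smul, LinearMap.smul_comp, LinearMap.comp_smul, hφ g]

variable {ρ : Γ → U ⊗[K] X →ₗ[U] U ⊗[K] X} {σ : Γ → U ⊗[K] Y →ₗ[U] U ⊗[K] Y}
  {τ : Γ → U ⊗[K] Z →ₗ[U] U ⊗[K] Z}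

lemma comp_mem_equivariantHom {ψ : Kbar ⊗[K] Y →ₗ[Kbar] Kbar ⊗[K] Z}
    {φ : Kbar ⊗[K] X →ₗ[Kbar] Kbar ⊗[K] Y} (hψ : ψ ∈ equivariantHom Kbar σ τ)
    (hφ : φ ∈ equivariantHom Kbar ρ σ) : ψ ∘ₗ φ ∈ equivariantHom Kbar ρ τ := fun g => by
  rw [extendToU_comp, LinearMap.comp_assoc, hφ g, ← LinearMap.comp_assoc, hψ g,
    LinearMap.comp_assoc]

lemma baseChange_mem_equivariantHom {f : X →ₗ[K] Y}
    (hf : ∀ g, f.baseChange U ∘ₗ ρ g = σ g ∘ₗ f.baseChange U) :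
    f.baseChange Kbar ∈ equivariantHom Kbar ρ σ := fun g => by
  rw [extendToU_baseChange, hf g]

lemma id_mem_equivariantHom : LinearMap.id ∈ equivariantHom Kbar ρ ρ := by
  rw [← LinearMap.baseChange_id]
  exact baseChange_mem_equivariantHom fun g => by
    rw [LinearMap.baseChange_id, LinearMap.id_comp, LinearMap.comp_id]

/-- An equivariant map killed by `π` factors equivariantly through the kernel of `π`. -/
lemma exists_equivariant_factor {i : X →ₗ[K] Y} {π : Y →ₗ[K] Z} (hi : Function.Injective i)
    (hex : Function.Exact i π) (hiρ : ∀ g, i.baseChange U ∘ₗ ρ g = σ g ∘ₗ i.baseChange U)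
    {W : Type*} [AddCommGroup W] [Module K W] {ω : Γ → U ⊗[K] W →ₗ[U] U ⊗[K] W}
    {f : Kbar ⊗[K] W →ₗ[Kbar] Kbar ⊗[K] Y} (hf : f ∈ equivariantHom Kbar ω σ)
    (hπ : π.baseChange Kbar ∘ₗ f = 0) :
    ∃ f' ∈ equivariantHom Kbar ω ρ, i.baseChange Kbar ∘ₗ f' = f := by
  -- The retraction `r` is merely `K`-linear, not equivariant. The composite `r ∘ f` is equivariant
  -- nevertheless: after composing with the injective equivariant `i` the claim becomes the
  -- equivariance of `f`.
  obtain ⟨r, hr⟩ := i.exists_leftInverse_of_injective (LinearMap.ker_eq_bot.2 hi)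
  have hrU : r.baseChange U ∘ₗ i.baseChange U = LinearMap.id := by
    rw [← LinearMap.baseChange_comp, hr, LinearMap.baseChange_id]
  have hrK : r.baseChange Kbar ∘ₗ i.baseChange Kbar = LinearMap.id := by
    rw [← LinearMap.baseChange_comp, hr, LinearMap.baseChange_id]
  have hexK : Function.Exact (i.baseChange Kbar) (π.baseChange Kbar) :=
    Module.Flat.lTensor_exact Kbar hex
  have hfac : i.baseChange Kbar ∘ₗ r.baseChange Kbar ∘ₗ f = f := by
    refine LinearMap.ext fun w => ?_
    obtain ⟨y, hy⟩ := (hexK (f w)).1 (LinearMap.congr_fun hπ w)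
    have := LinearMap.congr_fun hrK y
    simp only [LinearMap.comp_apply, ← hy] at this ⊢
    rw [this, LinearMap.id_apply]
  refine ⟨r.baseChange Kbar ∘ₗ f, fun g => ?_, hfac⟩
  have hinj : ∀ {a b : U ⊗[K] W →ₗ[U] U ⊗[K] X},
      i.baseChange U ∘ₗ a = i.baseChange U ∘ₗ b → a = b := by
    intro a b h
    have := congrArg (fun c => r.baseChange U ∘ₗ c) h
    simpa only [← LinearMap.comp_assoc, hrU, LinearMap.id_comp] using this
  have hU : i.baseChange U ∘ₗ extendToU (r.baseChange Kbar ∘ₗ f) = extendToU f := by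
    rw [← extendToU_baseChange (Kbar := Kbar) i, ← extendToU_comp, hfac]
  apply hinj
  rw [← LinearMap.comp_assoc, hU, hf g, ← LinearMap.comp_assoc, hiρ, LinearMap.comp_assoc, hU]

/-- A short exact sequence `0 → V → Y → V → 0` with `Kbar ⊗ Y ≅ Kbar ⊗ (V ⊕ V)` equivariantly
splits equivariantly over `Kbar`. -/
theorem exists_equivariant_section {V : Type*} [AddCommGroup V] [Module K V] [Module.Finite K V]
    {ρ : Γ → U ⊗[K] V →ₗ[U] U ⊗[K] V} {δ : Γ → U ⊗[K] Z →ₗ[U] U ⊗[K] Z}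
    {i : V →ₗ[K] Y} {π : Y →ₗ[K] V} (hi : Function.Injective i) (hex : Function.Exact i π)
    (hiρ : ∀ g, i.baseChange U ∘ₗ ρ g = σ g ∘ₗ i.baseChange U)
    (hπρ : ∀ g, π.baseChange U ∘ₗ σ g = ρ g ∘ₗ π.baseChange U)
    {j₀ j₁ : V →ₗ[K] Z} (hj₀ : ∀ g, j₀.baseChange U ∘ₗ ρ g = δ g ∘ₗ j₀.baseChange U)
    (hj₁ : ∀ g, j₁.baseChange U ∘ₗ ρ g = δ g ∘ₗ j₁.baseChange U)
    {q₀ q₁ : Z →ₗ[K] V} (h₀₀ : q₀ ∘ₗ j₀ = LinearMap.id) (h₀₁ : q₀ ∘ₗ j₁ = 0)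
    (h₁₀ : q₁ ∘ₗ j₀ = 0) (h₁₁ : q₁ ∘ₗ j₁ = LinearMap.id)
    [Module.Finite K Z]
    (φ : Kbar ⊗[K] Z ≃ₗ[Kbar] Kbar ⊗[K] Y)
    (hφ : φ.toLinearMap ∈ equivariantHom Kbar δ σ) :
    ∃ s ∈ equivariantHom Kbar ρ σ, π.baseChange Kbar ∘ₗ s = LinearMap.id := by
  have : Module.Finite Kbar (Kbar ⊗[K] Y) := Module.Finite.equiv φ
  have key : ∀ (q : Z →ₗ[K] V) (j : V →ₗ[K] Z),
      (q.baseChange Kbar ∘ₗ φ.symm.toLinearMap) ∘ₗ φ.toLinearMap ∘ₗ j.baseChange Kbar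
        = (q ∘ₗ j).baseChange Kbar := fun q j => by
    rw [LinearMap.baseChange_comp]
    ext
    simp
  have hj : ∀ {j : V →ₗ[K] Z}, (∀ g, j.baseChange U ∘ₗ ρ g = δ g ∘ₗ j.baseChange U) →
      ∀ f ∈ equivariantHom Kbar ρ ρ,
        (φ.toLinearMap ∘ₗ j.baseChange Kbar) ∘ₗ f ∈ equivariantHom Kbar ρ σ := fun h f hf =>
    comp_mem_equivariantHom (comp_mem_equivariantHom hφ (baseChange_mem_equivariantHom h)) hf
  -- The inclusions are transported by `φ` and the projections by its inverse. Equivariance of the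
  -- latter plays no role: they only witness linear independence of the two copies.
  exact exists_section_mem (q₀ := q₀.baseChange Kbar ∘ₗ φ.symm.toLinearMap)
    (q₁ := q₁.baseChange Kbar ∘ₗ φ.symm.toLinearMap) id_mem_equivariantHom
    (fun f hf => comp_mem_equivariantHom (baseChange_mem_equivariantHom hiρ) hf)
    (fun f hf => comp_mem_equivariantHom (baseChange_mem_equivariantHom hπρ) hf) (hj hj₀) (hj hj₁)
    (by rw [key, h₀₀, LinearMap.baseChange_id]) (by rw [key, h₀₁, LinearMap.baseChange_zero])
    (by rw [key, h₁₀, LinearMap.baseChange_zero]) (by rw [key, h₁₁, LinearMap.baseChange_id])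
    (fun f hf h => exists_equivariant_factor hi hex hiρ hf h)

end ExtendScalars

end DiffAlg

/-! ### The sequence `0 → V → V^{(1)} → V → 0` and the group actions -/

namespace DiffAlg

namespace Prolongation

lemma incl_apply {R M : Type*} [CommRing R] [Differential R] [AddCommGroup M] [Module R M] {p : ℕ}
    (m : M) : incl R M p m = single R 0 m := rfl

lemma incl_injective (R M : Type*) [CommRing R] [Differential R] [AddCommGroup M] [Module R M]
    (p : ℕ) : Function.Injective (incl R M p) := fun x y h => by
  have := congrFun h 0
  simpa only [incl_apply, single_apply, if_pos] using this

lemma sum_apply {R M κ : Type*} [CommRing R] [Differential R] [AddCommGroup M] [Module R M]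
    {p : ℕ} (t : Finset κ) (f : κ → Prolongation R M p) (k : Fin (p + 1)) :
    (∑ l ∈ t, f l) k = ∑ l ∈ t, f l k := Finset.sum_apply k t f

lemma leftCoeff_self {R : Type*} [CommRing R] [Differential R] (a : R) (k : ℕ) :
    leftCoeff a k k = a := by simp [leftCoeff]

/-- The projection `V^{(p)} → V` onto the coefficient of `∂^p`. -/
def top (R M : Type*) [CommRing R] [Differential R] [AddCommGroup M] [Module R M] (p : ℕ) :
    Prolongation R M p →ₗ[R] M where
  toFun x := x (Fin.last p)
  map_add' _ _ := rfl
  map_smul' a x := by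
    -- Left multiplication by `a` is triangular in the order of `∂`: the coefficient of `∂^p`
    -- receives nothing from lower orders and is itself scaled by `a`.
    rw [smul_apply, Finset.sum_eq_single (Fin.last p), leftCoeff_self, RingHom.id_apply]
    · intro i _ hi
      rw [leftCoeff_of_lt, zero_smul]
      exact Fin.lt_last_iff_ne_last.2 hi
    · simp

lemma top_apply {R M : Type*} [CommRing R] [Differential R] [AddCommGroup M] [Module R M] {p : ℕ}
    (x : Prolongation R M p) : top R M p x = x (Fin.last p) := rfl

lemma exact_incl_top (R M : Type*) [CommRing R] [Differential R] [AddCommGroup M] [Module R M] :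
    Function.Exact (incl R M 1) (top R M 1) := fun x => by
  constructor
  · intro h
    refine ⟨x 0, ?_⟩
    funext k
    fin_cases k
    · simp [incl_apply, single_apply]
    · simpa [incl_apply, single_apply, top_apply] using h.symm
  · rintro ⟨m, rfl⟩
    simp [incl_apply, top_apply, single_apply]

/-- The relation `a ∂ = ∂ a - a'`. Its last term is the source of `A'` in the equation `A' = B A - A
B`. -/
lemma smul_apply_zero_of_one {R M : Type*} [CommRing R] [Differential R] [AddCommGroup M]
    [Module R M] (a : R) (x : Prolongation R M 1) : (a • x) 0 = a • x 0 - a′ • x 1 := by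
  rw [smul_apply, Fin.sum_univ_two]
  simp [leftCoeff, iterDeriv_succ, sub_eq_add_neg]

section BaseChange

variable {K L V : Type*} [CommRing K] [Differential K] [CommRing L] [Differential L]
  [Algebra K L] [DifferentialAlgebra K L] [AddCommGroup V] [Module K V] {p : ℕ}

lemma baseChangeEquiv_tmul (l : L) (x : Prolongation K V p) :
    baseChangeEquiv K L V p (l ⊗ₜ x) = l • toBaseChange K L V p x := rfl

lemma baseChangeEquiv_incl (w : L ⊗[K] V) :
    baseChangeEquiv K L V p ((incl K V p).baseChange L w) = incl L (L ⊗[K] V) p w := by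
  induction w with
  | zero => simp
  | add a b ha hb => simp only [map_add, ha, hb]
  | tmul l v =>
    rw [LinearMap.baseChange_tmul, baseChangeEquiv_tmul, incl_apply, toBaseChange_single,
      ← incl_apply, ← map_smul, TensorProduct.smul_tmul', smul_eq_mul, mul_one]

lemma top_baseChangeEquiv (y : L ⊗[K] Prolongation K V p) :
    top L (L ⊗[K] V) p (baseChangeEquiv K L V p y) = (top K V p).baseChange L y := by
  induction y with
  | zero => simp
  | add a b ha hb => simp only [map_add, ha, hb]
  | tmul l x =>
    rw [LinearMap.baseChange_tmul, baseChangeEquiv_tmul, map_smul]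
    change l • ((1 : L) ⊗ₜ[K] x (Fin.last p)) = l ⊗ₜ x (Fin.last p)
    rw [TensorProduct.smul_tmul', smul_eq_mul, mul_one]

end BaseChange

/-- Coefficients computed over `Kbar` remain valid over `U` because the derivation of `U` extends
that of `Kbar`. -/
lemma baseChangeEquiv_toU {K Kbar U V : Type*} [Field K] [Differential K] [Field Kbar]
    [Differential Kbar] [Field U] [Differential U] [Algebra K Kbar] [DifferentialAlgebra K Kbar]
    [Algebra K U] [DifferentialAlgebra K U] [Algebra Kbar U] [DifferentialAlgebra Kbar U]
    [IsScalarTower K Kbar U] [AddCommGroup V] [Module K V] {p : ℕ}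
    (y : Kbar ⊗[K] Prolongation K V p) (k : Fin (p + 1)) :
    baseChangeEquiv K U V p (toU U _ y) k = toU U V (baseChangeEquiv K Kbar V p y k) := by
  induction y with
  | zero => simp [zero_apply]
  | add a b ha hb => simp only [map_add, add_apply, ha, hb]
  | tmul c x =>
    rw [toU_tmul, baseChangeEquiv_tmul, baseChangeEquiv_tmul, smul_apply, smul_apply, map_sum]
    refine Finset.sum_congr rfl fun i _ => ?_
    rw [leftCoeff_algebraMap, toU_smul]
    congr 1
    change (1 : U) ⊗ₜ[K] x i = toU U V (1 ⊗ₜ[K] x i)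
    rw [toU_tmul, map_one]

end Prolongation

section Actions

set_option linter.unusedSectionVars false

open Prolongation

variable {K U V : Type*} [Field K] [Differential K] [Field U] [Differential U] [Algebra K U]
  [AddCommGroup V] [Module K V]

/-- In `(U ⊗ V)^{(p)}` the action is coefficientwise, so equivariance is checked there. -/
lemma baseChangeEquiv_prolongAct [DifferentialAlgebra K U] (p : ℕ)
    (g : LinearMap.GeneralLinearGroup U (U ⊗[K] V)) (y : U ⊗[K] Prolongation K V p) :
    baseChangeEquiv K U V p (prolongAct p g y) =
      map p (g : U ⊗[K] V →ₗ[U] U ⊗[K] V) (baseChangeEquiv K U V p y) := by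
  simp [prolongAct]

lemma incl_equivariant [DifferentialAlgebra K U] (p : ℕ)
    (g : LinearMap.GeneralLinearGroup U (U ⊗[K] V)) :
    (incl K V p).baseChange U ∘ₗ (g : U ⊗[K] V →ₗ[U] U ⊗[K] V) =
      prolongAct p g ∘ₗ (incl K V p).baseChange U := by
  refine LinearMap.ext fun w => (baseChangeEquiv K U V p).injective ?_
  rw [LinearMap.comp_apply, LinearMap.comp_apply, baseChangeEquiv_prolongAct,
    baseChangeEquiv_incl, baseChangeEquiv_incl, incl_apply, incl_apply, map_single]

lemma top_equivariant [DifferentialAlgebra K U] (p : ℕ)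
    (g : LinearMap.GeneralLinearGroup U (U ⊗[K] V)) :
    (top K V p).baseChange U ∘ₗ prolongAct p g =
      (g : U ⊗[K] V →ₗ[U] U ⊗[K] V) ∘ₗ (top K V p).baseChange U := by
  refine LinearMap.ext fun y => ?_
  rw [LinearMap.comp_apply, LinearMap.comp_apply, ← top_baseChangeEquiv, ← top_baseChangeEquiv,
    baseChangeEquiv_prolongAct]
  rfl

lemma piRight_symm_pi_single (p : ℕ) (i : Fin (p + 1)) (w : U ⊗[K] V) :
    (TensorProduct.piRight K U U (fun _ : Fin (p + 1) => V)).symm (Pi.single i w) =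
      (LinearMap.single K (fun _ : Fin (p + 1) => V) i).baseChange U w := by
  induction w with
  | zero => simp
  | add a b ha hb => rw [Pi.single_add, map_add, map_add, ha, hb]
  | tmul u v => rw [TensorProduct.piRight_symm_single]; rfl

lemma directSumAct_single (p : ℕ) (i : Fin (p + 1))
    (g : LinearMap.GeneralLinearGroup U (U ⊗[K] V)) (w : U ⊗[K] V) :
    directSumAct p g ((LinearMap.single K (fun _ : Fin (p + 1) => V) i).baseChange U w) =
      (LinearMap.single K (fun _ : Fin (p + 1) => V) i).baseChange U
        ((g : U ⊗[K] V →ₗ[U] U ⊗[K] V) w) := by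
  rw [← piRight_symm_pi_single, ← piRight_symm_pi_single, directSumAct, LinearMap.comp_apply,
    LinearMap.comp_apply, LinearEquiv.coe_coe, LinearEquiv.coe_coe, LinearEquiv.apply_symm_apply]
  congr 1
  funext k
  by_cases h : k = i
  · subst h; simp
  · simp [Pi.single_eq_of_ne h]

end Actions

/-! ### Differentiating a conjugated matrix -/

section Matrices

open Matrix

variable {R ι : Type*} [CommRing R] [Differential R] [Fintype ι]

lemma map_deriv_mul (M N : Matrix ι ι R) :
    (M * N).map (fun x => x′) = M.map (fun x => x′) * N + M * N.map (fun x => x′) := by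
  ext i j
  simp only [map_apply, mul_apply, Matrix.add_apply, map_sum, Derivation.leibniz, smul_eq_mul,
    ← Finset.sum_add_distrib]
  exact Finset.sum_congr rfl fun k _ => by ring

/-- If `A' = B A - A B` and `D' = B D`, then `D⁻¹ A D` is constant. -/
lemma map_deriv_conj_eq_zero [DecidableEq ι] {A B : Matrix ι ι R} {D C : GL ι R}
    (hA : A.map (fun x => x′) + A * B = B * A)
    (hD : (D : Matrix ι ι R).map (fun x => x′) = B * (D : Matrix ι ι R))
    (hC : (D : Matrix ι ι R) * (C : Matrix ι ι R) = A * (D : Matrix ι ι R)) :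
    (C : Matrix ι ι R).map (fun x => x′) = 0 := by
  have h := congrArg (fun M => M.map (fun x : R => x′)) hC
  simp only [map_deriv_mul, hD] at h
  -- Differentiating `D C = A D` gives `B D C + D C' = A' D + A B D`, whose right side is `B A D = B
  -- D C`; hence `D C' = 0`.
  have h2 : (D : Matrix ι ι R) * (C : Matrix ι ι R).map (fun x => x′) = 0 := by
    have e1 : A.map (fun x => x′) * (D : Matrix ι ι R) + A * (B * (D : Matrix ι ι R))
        = B * (D : Matrix ι ι R) * (C : Matrix ι ι R) := by
      rw [← Matrix.mul_assoc, ← Matrix.add_mul, hA, Matrix.mul_assoc, Matrix.mul_assoc, hC]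
    rw [e1] at h
    exact add_eq_left.1 h
  have := congrArg (fun M => ((D⁻¹ : GL ι R) : Matrix ι ι R) * M) h2
  simpa [← Matrix.mul_assoc, ← Units.val_mul] using this

end Matrices

/-! ### From an isomorphism with `p = 1` to constant matrices -/

section Main

set_option linter.unusedSectionVars false

open Prolongation Matrix

variable {K Kbar U V ι : Type*} [Field K] [Differential K]
  [Field Kbar] [Differential Kbar] [Algebra K Kbar] [DifferentialAlgebra K Kbar]
  [Field U] [Differential U] [Algebra K U] [DifferentialAlgebra K U]
  [Algebra Kbar U] [DifferentialAlgebra Kbar U] [IsScalarTower K Kbar U]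
  [AddCommGroup V] [Module K V] [Fintype ι] [DecidableEq ι]

lemma apply_basis (b : Module.Basis ι K V) (g : LinearMap.GeneralLinearGroup U (U ⊗[K] V))
    (j : ι) : (g : U ⊗[K] V →ₗ[U] U ⊗[K] V) (b.baseChange U j) =
      ∑ k, (toMatrixGL b g : Matrix ι ι U) k j • b.baseChange U k := by
  have : (toMatrixGL b g : Matrix ι ι U) =
      LinearMap.toMatrix (b.baseChange U) (b.baseChange U) (g : U ⊗[K] V →ₗ[U] U ⊗[K] V) := rfl
  rw [this]
  simp only [LinearMap.toMatrix_apply]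
  exact ((b.baseChange U).sum_repr _).symm

lemma toU_baseChange_basis (b : Module.Basis ι K V) (j : ι) :
    toU U V (b.baseChange Kbar j) = b.baseChange U j := by
  simp

/-- An equivariant splitting of `V^{(1)} → V` over `Kbar` gives a matrix `B` over `Kbar` with
`A' = B A - A B` for all matrices `A` of elements of the group. -/
lemma exists_connection (b : Module.Basis ι K V)
    {G : Subgroup (LinearMap.GeneralLinearGroup U (U ⊗[K] V))}
    {s : Kbar ⊗[K] V →ₗ[Kbar] Kbar ⊗[K] Prolongation K V 1}
    (hs : s ∈ equivariantHom (Γ := G) Kbar (fun g => (g.1 : U ⊗[K] V →ₗ[U] U ⊗[K] V))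
      (fun g => prolongAct 1 g.1))
    (hπ : (top K V 1).baseChange Kbar ∘ₗ s = LinearMap.id) :
    ∃ B : Matrix ι ι Kbar, ∀ g ∈ G,
      (toMatrixGL b g : Matrix ι ι U).map (fun x => x′) +
          (toMatrixGL b g : Matrix ι ι U) * B.map (algebraMap Kbar U) =
        B.map (algebraMap Kbar U) * (toMatrixGL b g : Matrix ι ι U) := by
  -- Column `j` of `B` is the coefficient of `1` in `s(b_j)`; the coefficient of `∂` is `b_j` itself
  -- since `s` is a section.
  let B : Matrix ι ι Kbar := Matrix.of fun k j =>
    (b.baseChange Kbar).repr (baseChangeEquiv K Kbar V 1 (s (b.baseChange Kbar j)) 0) k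
  let T : U ⊗[K] V →ₗ[U] Prolongation U (U ⊗[K] V) 1 :=
    (baseChangeEquiv K U V 1).toLinearMap ∘ₗ extendToU s
  have hT (j : ι) (k : Fin 2) : T (b.baseChange U j) k =
      toU U V (baseChangeEquiv K Kbar V 1 (s (b.baseChange Kbar j)) k) := by
    rw [← baseChangeEquiv_toU, ← extendToU_toU, toU_baseChange_basis]
    rfl
  have hT1 (j : ι) : T (b.baseChange U j) 1 = b.baseChange U j := by
    have h := LinearMap.congr_fun hπ (b.baseChange Kbar j)
    rw [LinearMap.comp_apply, ← top_baseChangeEquiv] at h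
    exact (hT j 1).trans ((congrArg (toU U V) h).trans (toU_baseChange_basis b j))
  have hT0 (j : ι) : T (b.baseChange U j) 0 =
      ∑ k, algebraMap Kbar U (B k j) • b.baseChange U k := by
    rw [hT, ← (b.baseChange Kbar).sum_repr
      (baseChangeEquiv K Kbar V 1 (s (b.baseChange Kbar j)) 0), map_sum]
    refine Finset.sum_congr rfl fun k _ => ?_
    rw [toU_smul, toU_baseChange_basis]
    rfl
  refine ⟨B, fun g hg => ?_⟩
  ext i j
  have h1 : T ((g : U ⊗[K] V →ₗ[U] U ⊗[K] V) (b.baseChange U j)) 0 =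
      (g : U ⊗[K] V →ₗ[U] U ⊗[K] V) (T (b.baseChange U j) 0) := by
    have h := LinearMap.congr_fun (hs ⟨g, hg⟩) (b.baseChange U j)
    have h' := congrArg (baseChangeEquiv K U V 1) h
    simp only [LinearMap.comp_apply, baseChangeEquiv_prolongAct] at h'
    exact congrFun h' 0
  -- In coordinates the left side becomes column `j` of `B A - A'` and the right side column `j` of
  -- `A B`.
  rw [apply_basis, map_sum, Prolongation.sum_apply, hT0, map_sum] at h1
  simp only [map_smul, smul_apply_zero_of_one, hT0, hT1, apply_basis] at h1
  have h2 := congrArg (fun w => (b.baseChange U).repr w i) h1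
  simp only [map_sum, map_sub, map_smul, Finsupp.coe_finsetSum, Finset.sum_apply,
    Finsupp.coe_sub, Finsupp.coe_smul, Pi.sub_apply, Pi.smul_apply, Module.Basis.repr_self,
    Finsupp.single_apply, smul_eq_mul, mul_ite, mul_one, mul_zero, Finset.sum_ite_eq',
    Finset.mem_univ, if_true, Finset.sum_sub_distrib] at h2
  simp only [Matrix.add_apply, Matrix.mul_apply, Matrix.map_apply]
  rw [Finset.sum_congr rfl fun k _ => mul_comm _ (algebraMap Kbar U (B k j)), ← h2]
  simp only [mul_comm]
  ring

/-- A group of matrices satisfying `A' = B A - A B` is conjugate to a group of constant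
matrices. -/
lemma isConjugateToConstants_of_connection (hK : IsDifferentiallyClosed Kbar)
    (b : Module.Basis ι K V) {G : Subgroup (LinearMap.GeneralLinearGroup U (U ⊗[K] V))}
    {B : Matrix ι ι Kbar}
    (hB : ∀ g ∈ G, (toMatrixGL b g : Matrix ι ι U).map (fun x => x′) +
          (toMatrixGL b g : Matrix ι ι U) * B.map (algebraMap Kbar U) =
        B.map (algebraMap Kbar U) * (toMatrixGL b g : Matrix ι ι U)) :
    IsConjugateToConstants Kbar b G := by
  obtain ⟨D, hD⟩ := hK.exists_fundamental_matrix B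
  let D' : GL ι U := GeneralLinearGroup.map (algebraMap Kbar U) D
  have hD' : (D' : Matrix ι ι U).map (fun x => x′) =
      B.map (algebraMap Kbar U) * (D' : Matrix ι ι U) := by
    have h := congrArg (fun M => M.map (algebraMap Kbar U)) hD
    simp only [Matrix.map_mul] at h
    refine Eq.trans ?_ h
    ext i j
    exact deriv_algebraMap (A := Kbar) (B := U) _
  have hconst (g) (hg : g ∈ G) (i j : ι) :
      (D'⁻¹ * toMatrixGL b g * D' : GL ι U) i j ∈ constants U := by
    have := map_deriv_conj_eq_zero (C := D'⁻¹ * toMatrixGL b g * D') (hB g hg) hD' (by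
      rw [← Units.val_mul, ← Units.val_mul]
      congr 1
      group)
    exact congrFun (congrFun this i) j
  -- A preimage only sees elements that lift to constants; that all of `D⁻¹ G D` lifts is the
  -- content of the first inclusion below.
  let H : Subgroup (GL ι (constants U)) :=
    ((G.map (toMatrixGL b)).map (MulAut.conj D'⁻¹).toMonoidHom).comap
      (GeneralLinearGroup.map (constants U).subtype)
  refine ⟨D, H, Set.ext fun M => ⟨?_, ?_⟩⟩
  · rintro ⟨g, hg, rfl⟩
    -- The inverse comes from `g⁻¹ ∈ G`, so its entries are constant too and the lift is invertible
    -- over the constants.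
    have hinv : (D'⁻¹ * toMatrixGL b g * D')⁻¹ = D'⁻¹ * toMatrixGL b g⁻¹ * D' := by
      rw [map_inv]; group
    have hinj : Function.Injective
        (fun N : Matrix ι ι (constants U) => N.map (constants U).subtype) :=
      Matrix.map_injective Subtype.val_injective
    let N : Matrix ι ι (constants U) := Matrix.of fun i j => ⟨_, hconst g hg i j⟩
    let N' : Matrix ι ι (constants U) := Matrix.of fun i j => ⟨_, hconst g⁻¹ (inv_mem hg) i j⟩
    have hN : N.map (constants U).subtype = (D'⁻¹ * toMatrixGL b g * D' : GL ι U) := rfl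
    have hN' : N'.map (constants U).subtype = ((D'⁻¹ * toMatrixGL b g * D')⁻¹ : GL ι U) := by
      rw [hinv]; rfl
    let C : GL ι (constants U) := ⟨N, N', hinj (by
        simp only [Matrix.map_mul, hN, hN', ← Units.val_mul, mul_inv_cancel]
        simp), hinj (by
        simp only [Matrix.map_mul, hN, hN', ← Units.val_mul, inv_mul_cancel]
        simp)⟩
    have hC : GeneralLinearGroup.map (constants U).subtype C = D'⁻¹ * toMatrixGL b g * D' :=
      Units.ext hN
    refine ⟨C, ?_, hC⟩
    refine ⟨toMatrixGL b g, ⟨g, hg, rfl⟩, ?_⟩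
    rw [hC]
    simp
  · rintro ⟨C, ⟨_, ⟨g, hg, rfl⟩, h⟩, rfl⟩
    refine ⟨g, hg, ?_⟩
    rw [← h]
    simp [D']

theorem isConjugateToConstants_of_equiv (hK : IsDifferentiallyClosed Kbar)
    (b : Module.Basis ι K V) {G : Subgroup (LinearMap.GeneralLinearGroup U (U ⊗[K] V))}
    (φ : Kbar ⊗[K] (Fin 2 → V) ≃ₗ[Kbar] Kbar ⊗[K] Prolongation K V 1)
    (hφ : IsEquivariant G 1 φ.toLinearMap) : IsConjugateToConstants Kbar b G := by
  have : Module.Finite K V := Module.Finite.of_basis b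
  obtain ⟨s, hs, hπ⟩ := exists_equivariant_section (Γ := G) (Kbar := Kbar)
    (ρ := fun g => (g.1 : U ⊗[K] V →ₗ[U] U ⊗[K] V)) (σ := fun g => prolongAct 1 g.1)
    (δ := fun g => directSumAct 1 g.1) (incl_injective K V 1) (exact_incl_top K V)
    (fun g => incl_equivariant 1 g.1) (fun g => top_equivariant 1 g.1)
    (j₀ := LinearMap.single K (fun _ : Fin 2 => V) 0)
    (j₁ := LinearMap.single K (fun _ : Fin 2 => V) 1)
    (fun g => LinearMap.ext fun w => (directSumAct_single 1 0 g.1 w).symm)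
    (fun g => LinearMap.ext fun w => (directSumAct_single 1 1 g.1 w).symm)
    (q₀ := LinearMap.proj 0) (q₁ := LinearMap.proj 1)
    (LinearMap.ext fun v => by simp) (LinearMap.ext fun v => by simp)
    (LinearMap.ext fun v => by simp) (LinearMap.ext fun v => by simp)
    φ (fun g => hφ g.1 g.2)
  obtain ⟨B, hB⟩ := exists_connection b hs hπ
  exact isConjugateToConstants_of_connection hK b hB

end Main

end DiffAlg

/-! ### From constant matrices to isomorphisms for every `p` -/

namespace DiffAlg

section ConstantsToIso

set_option linter.unusedSectionVars false

open Prolongation Matrix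

/-- The basis `e_j = ∑_k D_{kj} b_k` obtained from a basis `b` and an invertible matrix `D`. -/
lemma exists_basis_of_GL {F M ι : Type*} [Field F] [AddCommGroup M] [Module F M] [Fintype ι]
    [DecidableEq ι] (b : Module.Basis ι F M) (D : GL ι F) :
    ∃ e : Module.Basis ι F M, ∀ j, e j = ∑ k, (D : Matrix ι ι F) k j • b k :=
  ⟨b.map (Matrix.toLinearEquiv b D ((Matrix.isUnit_iff_isUnit_det _).1 D.isUnit)), fun j => by
    simp [Matrix.toLin_self]⟩

/-- The linear map `M^{p+1} → M^{(p)}` sending `e_j` in the `i`-th summand to `∂^i ⊗ e_j`. -/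
noncomputable def prolongBasisMap {F M ι : Type*} [Field F] [Differential F] [AddCommGroup M]
    [Module F M] [Fintype ι] (e : Module.Basis ι F M) (p : ℕ) :
    (Fin (p + 1) → M) →ₗ[F] Prolongation F M p :=
  LinearMap.lsum F (fun _ : Fin (p + 1) => M) F
    fun i => e.constr F fun j => (single F i (e j) : Prolongation F M p)

section

variable {F M ι : Type*} [Field F] [Differential F] [AddCommGroup M] [Module F M] [Fintype ι]
  (e : Module.Basis ι F M) {p : ℕ}

lemma prolongBasisMap_single (i : Fin (p + 1)) (j : ι) :
    prolongBasisMap e p (Pi.single i (e j)) = single F i (e j) := by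
  rw [prolongBasisMap, LinearMap.lsum_piSingle, Module.Basis.constr_basis]

/-- In order zero, `m ↦ 1 ⊗ m` is linear, so the choice of basis does not matter. This gives the
normalisation on the first summand. -/
lemma prolongBasisMap_single_zero (m : M) :
    prolongBasisMap e p (Pi.single 0 m) = incl F M p m := by
  have h : prolongBasisMap e p ∘ₗ LinearMap.single F (fun _ : Fin (p + 1) => M) 0 = incl F M p :=
    e.ext fun j => prolongBasisMap_single e 0 j
  exact LinearMap.congr_fun h m

lemma prolongBasisMap_apply (x : Fin (p + 1) → M) (k : Fin (p + 1)) :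
    prolongBasisMap e p x k = ∑ i : Fin (p + 1), ∑ j, leftCoeff (e.repr (x i) j) k i • e j := by
  rw [prolongBasisMap, LinearMap.lsum_apply, LinearMap.sum_apply, Prolongation.sum_apply]
  refine Finset.sum_congr rfl fun i _ => ?_
  rw [LinearMap.comp_apply, LinearMap.proj_apply, Module.Basis.constr_apply_fintype, Prolongation.sum_apply]
  refine Finset.sum_congr rfl fun j _ => ?_
  simp [Prolongation.smul_apply, Prolongation.single_apply, Module.Basis.equivFun_apply]

/-- The map is triangular in the order of `∂`: the coefficient of `∂^k` involves only `x_i` with `i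
≥ k`, and `x_k` enters as itself. The `x_k` therefore vanish by descending induction from `k = p`.
-/
lemma prolongBasisMap_injective : Function.Injective (prolongBasisMap e p) := by
  rw [← LinearMap.ker_eq_bot, LinearMap.ker_eq_bot']
  intro x hx
  have key : ∀ n : ℕ, ∀ k : Fin (p + 1), p - k < n → x k = 0 := by
    intro n
    induction n with
    | zero => intro k hk; omega
    | succ n ih =>
      intro k hk
      have h := congrFun hx k
      rw [prolongBasisMap_apply, Finset.sum_eq_single k] at h
      · simp only [leftCoeff_self, e.sum_repr] at h
        exact h
      · intro i _ hi
        rcases lt_or_gt_of_ne hi with h' | h'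
        · exact Finset.sum_eq_zero fun j _ => by rw [leftCoeff_of_lt _ h', zero_smul]
        · have h'' : (k : ℕ) < i := h'
          rw [ih i (by omega)]
          simp [leftCoeff_zero]
      · simp
  funext k
  exact key _ k (Nat.lt_succ_self _)

/-- By the Leibniz rule `∂^i ⊗ a e_j` is a left combination of the `∂^k ⊗ e_j`, which are in the
image. -/
lemma prolongBasisMap_surjective : Function.Surjective (prolongBasisMap e p) := by
  rw [← LinearMap.range_eq_top, eq_top_iff]
  rintro x -
  rw [← sum_single (R := F) x]
  refine Submodule.sum_mem _ fun i _ => ?_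
  rw [← e.sum_repr (x i), map_sum]
  refine Submodule.sum_mem _ fun j _ => ?_
  rw [single_smul]
  exact Submodule.sum_mem _ fun k _ =>
    Submodule.smul_mem _ _ ⟨_, prolongBasisMap_single e k j⟩

end

variable {K Kbar U V ι : Type*} [Field K] [Differential K]
  [Field Kbar] [Differential Kbar] [Algebra K Kbar] [DifferentialAlgebra K Kbar]
  [Field U] [Differential U] [Algebra K U] [DifferentialAlgebra K U]
  [Algebra Kbar U] [DifferentialAlgebra Kbar U] [IsScalarTower K Kbar U]
  [AddCommGroup V] [Module K V] [Fintype ι] [DecidableEq ι]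

/-- All Leibniz terms with a derivative of `a` vanish. This is where constancy of the matrices makes
the action commute with `∂^i`. -/
lemma single_smul_of_const {R M : Type*} [CommRing R] [Differential R] [AddCommGroup M]
    [Module R M] {p : ℕ} {a : R} (ha : a′ = 0) (i : Fin (p + 1)) (m : M) :
    (single R i (a • m) : Prolongation R M p) = a • single R i m := by
  have h : ∀ n, iterDeriv (n + 1) a = 0 := fun n => by
    induction n with
    | zero => simpa [iterDeriv_succ] using ha
    | succ n ih => rw [iterDeriv_succ, ih]; simp
  rw [single_smul, Finset.sum_eq_single i]
  · simp
  · intro j _ hj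
    rcases lt_or_gt_of_ne hj with h' | h'
    · have h'' : (j : ℕ) < i := h'
      obtain ⟨n, hn⟩ := Nat.exists_eq_add_of_lt h''
      rw [show (i : ℕ) - j = n + 1 by omega, h, mul_zero, zero_smul]
    · have h'' : (i : ℕ) < j := h'
      simp [Nat.choose_eq_zero_of_lt h'']
  · simp

/-- The isomorphism `Kbar ⊗ (V ⊕ V_1 ⊕ ⋯ ⊕ V_p) ≅ Kbar ⊗ V^{(p)}` attached to a basis of
`Kbar ⊗ V`. -/
noncomputable def prolongBasisEquiv (e : Module.Basis ι Kbar (Kbar ⊗[K] V)) (p : ℕ) :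
    Kbar ⊗[K] (Fin (p + 1) → V) ≃ₗ[Kbar] Kbar ⊗[K] Prolongation K V p :=
  TensorProduct.piRight K Kbar Kbar (fun _ : Fin (p + 1) => V) ≪≫ₗ
    LinearEquiv.ofBijective (prolongBasisMap e p)
      ⟨prolongBasisMap_injective e, prolongBasisMap_surjective e⟩ ≪≫ₗ
    (baseChangeEquiv K Kbar V p).symm

lemma baseChangeEquiv_prolongBasisEquiv (e : Module.Basis ι Kbar (Kbar ⊗[K] V)) (p : ℕ)
    (i : Fin (p + 1)) (m : Kbar ⊗[K] V) :
    baseChangeEquiv K Kbar V p (prolongBasisEquiv e p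
      ((LinearMap.single K (fun _ : Fin (p + 1) => V) i).baseChange Kbar m)) =
        prolongBasisMap e p (Pi.single i m) := by
  rw [← piRight_symm_pi_single]
  simp only [prolongBasisEquiv, LinearEquiv.trans_apply, LinearEquiv.apply_symm_apply]
  rfl

lemma toU_baseChange {X Y : Type*} [AddCommGroup X] [Module K X] [AddCommGroup Y] [Module K Y]
    (f : X →ₗ[K] Y) (y : Kbar ⊗[K] X) :
    toU U Y (f.baseChange Kbar y) = f.baseChange U (toU U X y) := by
  rw [← extendToU_toU, extendToU_baseChange]

theorem exists_equiv_of_isConjugateToConstants (b : Module.Basis ι K V)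
    {G : Subgroup (LinearMap.GeneralLinearGroup U (U ⊗[K] V))}
    (hG : IsConjugateToConstants Kbar b G) (p : ℕ) :
    ∃ φ : Kbar ⊗[K] (Fin (p + 1) → V) ≃ₗ[Kbar] Kbar ⊗[K] Prolongation K V p,
      IsEquivariant G p φ.toLinearMap ∧
        ∀ (c : Kbar) (v : V), φ (c ⊗ₜ[K] Pi.single 0 v) = c ⊗ₜ[K] incl K V p v := by
  obtain ⟨D, H, hH⟩ := hG
  obtain ⟨e, he⟩ := exists_basis_of_GL (b.baseChange Kbar) D
  -- `u` is the image of the basis `e` in `U ⊗ V`, where `G` acts.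
  obtain ⟨u, hu⟩ := exists_basis_of_GL (b.baseChange U)
    (GeneralLinearGroup.map (algebraMap Kbar U) D)
  have heu (j : ι) : toU U V (e j) = u j := by
    rw [he, hu, map_sum]
    refine Finset.sum_congr rfl fun k _ => ?_
    rw [toU_smul, toU_baseChange_basis]
    rfl
  refine ⟨prolongBasisEquiv e p, fun g hg => ?_, fun c v => ?_⟩
  -- `C = D⁻¹ A D` is the matrix of `g` in the basis `u`; the relation `A D = D C` is read off
  -- column by column.
  · obtain ⟨C, hC, hCg⟩ : ∃ C : Matrix ι ι U, (∀ i j, (C i j)′ = 0) ∧ ∀ j,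
        (g : U ⊗[K] V →ₗ[U] U ⊗[K] V) (u j) = ∑ k, C k j • u k := by
      obtain ⟨C, -, hC⟩ := (Set.ext_iff.1 hH _).1 ⟨g, hg, rfl⟩
      refine ⟨GeneralLinearGroup.map (constants U).subtype C, fun i j => (C i j).2, fun j => ?_⟩
      have hDC : (toMatrixGL b g : Matrix ι ι U) *
          (GeneralLinearGroup.map (algebraMap Kbar U) D : GL ι U) =
          (GeneralLinearGroup.map (algebraMap Kbar U) D : GL ι U) *
          (GeneralLinearGroup.map (constants U).subtype C : GL ι U) := by
        rw [hC, ← Units.val_mul, ← Units.val_mul]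
        congr 1
        group
      have hDC' (l : ι) := congrFun (congrFun hDC l) j
      simp only [hu, map_sum, map_smul, apply_basis, Finset.smul_sum, smul_smul]
      rw [Finset.sum_comm]
      symm
      rw [Finset.sum_comm]
      refine Finset.sum_congr rfl fun l _ => ?_
      simp only [← Finset.sum_smul]
      congr 1
      refine Eq.trans ?_ ((hDC' l).symm.trans ?_)
      · exact Finset.sum_congr rfl fun k _ => mul_comm _ _
      · exact Finset.sum_congr rfl fun k _ => mul_comm _ _
    have hφ (i : Fin (p + 1)) (j : ι) : baseChangeEquiv K U V p
        (extendToU (U := U) (prolongBasisEquiv e p).toLinearMap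
          ((LinearMap.single K (fun _ : Fin (p + 1) => V) i).baseChange U (u j))) =
        single U i (u j) := by
      rw [← heu, ← toU_baseChange, extendToU_toU]
      funext k
      rw [baseChangeEquiv_toU, LinearEquiv.coe_coe, baseChangeEquiv_prolongBasisEquiv,
        prolongBasisMap_single, Prolongation.single_apply,
        Prolongation.single_apply]
      split_ifs <;> simp
    have hext : ∀ {f f' : U ⊗[K] (Fin (p + 1) → V) →ₗ[U] U ⊗[K] Prolongation K V p},
        (∀ i j, f ((LinearMap.single K (fun _ : Fin (p + 1) => V) i).baseChange U (u j)) =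
          f' ((LinearMap.single K (fun _ : Fin (p + 1) => V) i).baseChange U (u j))) →
        f = f' := by
      intro f f' h
      have h' : f ∘ₗ (TensorProduct.piRight K U U (fun _ : Fin (p + 1) => V)).symm.toLinearMap =
          f' ∘ₗ (TensorProduct.piRight K U U (fun _ : Fin (p + 1) => V)).symm.toLinearMap := by
        refine LinearMap.pi_ext' fun i => u.ext fun j => ?_
        simp only [LinearMap.comp_apply, LinearMap.coe_single, LinearEquiv.coe_coe,
          piRight_symm_pi_single, h]
      refine LinearMap.ext fun y => ?_
      simpa [-TensorProduct.piRight_apply] using LinearMap.congr_fun h'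
        (TensorProduct.piRight K U U (fun _ : Fin (p + 1) => V) y)
    refine hext fun i j => (baseChangeEquiv K U V p).injective ?_
    rw [LinearMap.comp_apply, LinearMap.comp_apply, directSumAct_single,
      baseChangeEquiv_prolongAct, hφ, Prolongation.map_single, hCg]
    -- Both sides equal `∑ C_kj (∂^i ⊗ u_k)`, since the constants `C_kj` pass through `∂^i`.
    simp only [map_sum, map_smul, hφ, single_smul_of_const (hC _ _)]
  · apply (baseChangeEquiv K Kbar V p).injective
    have h := baseChangeEquiv_prolongBasisEquiv e p 0 (c ⊗ₜ[K] v)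
    rw [prolongBasisMap_single_zero, ← baseChangeEquiv_incl] at h
    simpa using h

end ConstantsToIso

end DiffAlg

/-! ### The equivalences -/

theorem mainTheorem7 {K Kbar U V ι : Type*}
    [Field K] [CharZero K] [Differential K]
    [Field Kbar] [Differential Kbar] [Algebra K Kbar] [DifferentialAlgebra K Kbar]
    (hKbar : DiffAlg.IsDifferentialClosure K Kbar)
    [Field U] [Differential U] [Algebra K U] [DifferentialAlgebra K U]
    [Algebra Kbar U] [DifferentialAlgebra Kbar U] [IsScalarTower K Kbar U]
    [AddCommGroup V] [Module K V] [Fintype ι] [DecidableEq ι] (b : Module.Basis ι K V)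
    (G : Subgroup (LinearMap.GeneralLinearGroup U (U ⊗[K] V)))
    (hG : DiffAlg.IsKolchinClosed b (G : Set (LinearMap.GeneralLinearGroup U (U ⊗[K] V)))) :
    (DiffAlg.IsConjugateToConstants Kbar b G ↔
      ∀ p : ℕ, 1 ≤ p →
        ∃ φ : Kbar ⊗[K] (Fin (p + 1) → V) ≃ₗ[Kbar] Kbar ⊗[K] DiffAlg.Prolongation K V p,
          DiffAlg.IsEquivariant G p φ.toLinearMap) ∧
    (DiffAlg.IsConjugateToConstants Kbar b G ↔
      ∀ p : ℕ, 1 ≤ p →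
        ∃ φ : Kbar ⊗[K] (Fin (p + 1) → V) ≃ₗ[Kbar] Kbar ⊗[K] DiffAlg.Prolongation K V p,
          DiffAlg.IsEquivariant G p φ.toLinearMap ∧
          ∀ (c : Kbar) (v : V),
            φ (c ⊗ₜ[K] Pi.single 0 v) = c ⊗ₜ[K] DiffAlg.Prolongation.incl K V p v) := by
  have h13 (h : DiffAlg.IsConjugateToConstants Kbar b G) (p : ℕ) :=
    DiffAlg.exists_equiv_of_isConjugateToConstants b h p
  refine ⟨⟨fun h p _ => ?_, fun h => ?_⟩, ⟨fun h p _ => h13 h p, fun h => ?_⟩⟩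
  · obtain ⟨φ, hφ, -⟩ := h13 h p
    exact ⟨φ, hφ⟩
  -- The single case `p = 1` already forces condition 1, and hence the isomorphisms for all `p`.
  · obtain ⟨φ, hφ⟩ := h 1 le_rfl
    exact DiffAlg.isConjugateToConstants_of_equiv hKbar.closed b φ hφ
  · obtain ⟨φ, hφ, -⟩ := h 1 le_rfl
    exact DiffAlg.isConjugateToConstants_of_equiv hKbar.closed b φ hφ
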